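/- **Notation.** Let $\Bbbk$ be a field and $q\in\Bbbk^{\times}$. For $n\ge 0$ let $B_n$ be the Artin braid group with generators $\sigma_1,\dots,\sigma_{n-1}$ and relations $\sigma_i\sigma_j\sigma_i=\sigma_j\sigma_i\sigma_j$ for $|i-j|=1$, $\sigma_i\sigma_j=\sigma_j\sigma_i$ for $|i-j|>1$ (so $B_0,B_1$ are trivial). For $\ell+m\le n$ write $w\mapsto w^{\uparrow\ell}$ for the algebra homomorphism $\Bbbk B_m\to\Bbbk B_n$, $\sigma_i\mapsto\sigma_{i+\ell}$; for $\ell=0$ it is the inclusion of the braid group tower and is omitted from the notation. Put, for $a,b,m,n\in\mathbb Z_{\ge0}$ and $x,y\in\Bbbk$: * $\beta_{a,b}=(\sigma_a\sigma_{a+1}\cdots\sigma_{a+b-1})(\sigma_{a-1}\sigma_a\cdots\sigma_{a+b-2})\cdots(\sigma_1\sigma_2\cdots\sigma_b)\in B_{a+b}$; * $Ш_{m,n}\in\Bbbk B_{m+n}$ (braid shuffle elements), defined by $Ш_{0,n}=Ш_{m,0}=1$ and $Ш_{m,n}=Ш_{m-1,n}+Ш_{m,n-1}\,\beta_{m,1}^{\uparrow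 n-1}$ for $m,n\ge1$; moreover $Ш_{m,n}=0$ if $m<0$ or $n<0$; * $P_{a,n}(x,y)=(x-\beta_{a,1}y)(x-\beta_{a+1,1}y)\cdots(x-\beta_{a+n-1,1}y)\in\Bbbk B_{a+n}$ (braid Pochhammer symbols), and $p_{a,b}=P_{a,b}(1,q^{-2})$. A *braiding* on a vector space $W$ over $\Bbbk$ is an invertible $R\in\mathrm{End}(W\otimes W)$ with $R_{12}R_{23}R_{12}=R_{23}R_{12}R_{23}$ on $W^{\otimes 3}$. Its *local representation* is $\rho_R:B_n\to\mathrm{Aut}(W^{\otimes n})$, where $\rho_R(\sigma_i)$ acts as $R$ on the copies $i,i+1$ of $W$ and as the identity on the other copies; $\rho_R$ is extended linearly to $\Bbbk B_n$. **Theorem.** Let $$A^{a,b}_c=q^{1-a-c}\;Ш_{b-c,c}^{\uparrow a}\;\beta_{a,c}\;p_{a,b-c}^{\uparrow c}\in\Bbbk B_{a+b}\qquad(0\le c\le b),\qquad A^{a,b}_c=0\quad(c>b).$$ 1. These elements are a universal solution of the block-triangular Yang–Baxter system: for all $a,b,c,e,f\in\mathbb Z_{\ge0}$, $$\sum_{i}\bigl(A^{b,c}_{i}\bigr)^{\uparrow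 a}A^{a,i}_{e}\bigl(A^{a+i-e,\,b+c-i}_{f}\bigr)^{\uparrow e}=\sum_{j}A^{a,b}_{j}\bigl(A^{a+b-j,\,c}_{f+e-j}\bigr)^{\uparrow j}A^{j,\,f+e-j}_{e}$$ in $\Bbbk B_{a+b+c}$, where $i$ runs over $e\le i\le\min(c,b+c-f)$ and $j$ over $\max(0,f+e-c)\le j\le\min(f,b)$. 2. Let $\hat R$ be a braiding on a $\Bbbk$-vector space $V$, and let $T(V)=\bigoplus_{n\ge0}V^{\otimes n}$. Let $T(\hat R)\in\mathrm{End}(T(V)\otimes T(V))$ be the operator whose block from $V^{\otimes m}\otimes V^{\otimes l}$ to $V^{\otimes b}\otimes V^{\otimes c}$ is $\rho_{q\hat R}(A^{b,c}_m)$ when $m+l=b+c$ (both spaces being identified with $V^{\otimes(b+c)}$) and $0$ otherwise. Then $T(\hat R)$ is a braiding on $T(V)$, i.e. it is invertible and satisfies the Yang–Baxter equation. 3. The braiding is functorial: let $\hat R,\hat R'$ be braidings on $\Bbbk$-vector spaces $V,V'$, let $f:V\to V'$ be linear with $(f\otimes f)\hat R=\hat R'(f\otimes f)$, and let $T(f):T(V)\to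 T(V')$ be the map that restricts to $f\otimes\cdots\otimes f$ on each $V^{\otimes n}$. Then $(T(f)\otimes T(f))\,T(\hat R)=T(\hat R')\,(T(f)\otimes T(f))$. -/

import Mathlib

open scoped TensorProduct DirectSum

noncomputable section

namespace BraidTensor

universe u v w

/-! ### Braid groups -/

/-- The relators of the Artin presentation of `B_n`. The generator with index `i` (counted from `0`)
is the one which is usually called `σ_{i+1}`; there are `n - 1` of them. -/
def artinRels (n : ℕ) : Set (FreeGroup (Fin (n - 1))) :=
  {r | ∃ i j : Fin (n - 1), (i : ℕ) + 1 = j ∧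
    r = FreeGroup.of i * FreeGroup.of j * FreeGroup.of i *
      (FreeGroup.of j * FreeGroup.of i * FreeGroup.of j)⁻¹} ∪
  {r | ∃ i j : Fin (n - 1), (i : ℕ) + 1 < j ∧
    r = FreeGroup.of i * FreeGroup.of j * (FreeGroup.of j * FreeGroup.of i)⁻¹}

/-- The Artin braid group `B_n` on `n` strands (trivial for `n = 0, 1`). -/
abbrev BraidGroup (n : ℕ) : Type := PresentedGroup (artinRels n)

/-- The Artin generator of `B_n` with index `i < n - 1` counted from `0`; it crosses the strands
`i` and `i + 1` (also counted from `0`). Out of range it is set to `1`, which is never used. -/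
def sigma (n i : ℕ) : BraidGroup n :=
  if h : i < n - 1 then PresentedGroup.of (⟨i, h⟩ : Fin (n - 1)) else 1

theorem sigma_braid (n i : ℕ) (h : i + 1 < n - 1) :
    sigma n i * sigma n (i + 1) * sigma n i = sigma n (i + 1) * sigma n i * sigma n (i + 1) := by
  have hi : i < n - 1 := by omega
  simp only [sigma, dif_pos h, dif_pos hi]
  rw [← mul_inv_eq_one]
  exact PresentedGroup.one_of_mem (rels := artinRels n) (Or.inl ⟨⟨i, hi⟩, ⟨i + 1, h⟩, rfl, rfl⟩)

theorem sigma_comm (n i j : ℕ) (hij : i + 1 < j) (h : j < n - 1) :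
    sigma n i * sigma n j = sigma n j * sigma n i := by
  have hi : i < n - 1 := by omega
  simp only [sigma, dif_pos h, dif_pos hi]
  rw [← mul_inv_eq_one]
  exact PresentedGroup.one_of_mem (rels := artinRels n) (Or.inr ⟨⟨i, hi⟩, ⟨j, h⟩, hij, rfl⟩)

/-- To define a homomorphism from `B_n` it suffices to check the Artin relations. -/
def liftBraid {G : Type*} [Group G] (n : ℕ) (s : ℕ → G)
    (hb : ∀ i, i + 1 < n - 1 → s i * s (i + 1) * s i = s (i + 1) * s i * s (i + 1))
    (hc : ∀ i j, i + 1 < j → j < n - 1 → s i * s j = s j * s i) : BraidGroup n →* G :=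
  PresentedGroup.toGroup (rels := artinRels n) (f := fun i : Fin (n - 1) => s i) (by
    rintro r (⟨i, j, hij, rfl⟩ | ⟨i, j, hij, rfl⟩)
    · have := hb i (by have := j.2; omega)
      simp only [map_mul, map_inv, FreeGroup.lift_apply_of, ← hij]
      rw [this, mul_inv_cancel]
    · have := hc i j hij j.2
      simp only [map_mul, map_inv, FreeGroup.lift_apply_of]
      rw [this, mul_inv_cancel])

theorem liftBraid_sigma {G : Type*} [Group G] (n : ℕ) (s : ℕ → G) (hb) (hc) (i : ℕ)
    (h : i < n - 1) : liftBraid n s hb hc (sigma n i) = s i := by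
  simp only [sigma, dif_pos h, liftBraid]
  exact PresentedGroup.toGroup.of _

/-- The shift `w ↦ w^{↑ℓ}`, `σ_i ↦ σ_{i+ℓ}`, regarded as a homomorphism `B_m → B_n` for `ℓ + m ≤ n`.
For `ℓ = 0` it is the inclusion `B_m ⊂ B_n` of the braid group tower. (Outside the range
`ℓ + m ≤ n` it is set to be trivial; it is only used in the range.) -/
def shiftGroup (l m n : ℕ) : BraidGroup m →* BraidGroup n :=
  if h : l + m ≤ n then
    liftBraid m (fun i => sigma n (i + l))
      (fun i hi => by
        have := sigma_braid n (i + l) (by omega)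
        rwa [show i + l + 1 = i + 1 + l by omega] at this)
      (fun i j hij hj => sigma_comm n (i + l) (j + l) (by omega) (by omega))
  else 1

/-- The shift `x ↦ x^{↑ℓ}` on group algebras of braid groups, `𝕜B_m → 𝕜B_n` for `ℓ + m ≤ n`;
for `ℓ = 0` the inclusion `𝕜B_m ⊂ 𝕜B_n`. -/
def up {k : Type u} [Field k] (l : ℕ) {m n : ℕ} :
    MonoidAlgebra k (BraidGroup m) →ₐ[k] MonoidAlgebra k (BraidGroup n) :=
  MonoidAlgebra.mapDomainAlgHom k k (shiftGroup l m n)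

/-! ### Distinguished elements of the group algebras of braid groups -/

/-- The braid
`β_{a,b} = (σ_a σ_{a+1} ⋯ σ_{a+b-1}) (σ_{a-1} σ_a ⋯ σ_{a+b-2}) ⋯ (σ_1 σ_2 ⋯ σ_b) ∈ B_{a+b}`. -/
def betaBraid (a b : ℕ) : BraidGroup (a + b) :=
  ((List.range a).map fun i => ((List.range b).map fun j => sigma (a + b) (a - 1 - i + j)).prod).prod

/-- `β_{a,b}` as an element of the group algebra. -/
def beta (k : Type u) [Field k] (a b : ℕ) : MonoidAlgebra k (BraidGroup (a + b)) :=
  MonoidAlgebra.of k _ (betaBraid a b)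

/-- The braid shuffle elements `Ш_{m,n} ∈ 𝕜B_{m+n}`, for `m, n ≥ 0`: `Ш_{0,n} = Ш_{m,0} = 1` and
`Ш_{m,n} = Ш_{m-1,n} + Ш_{m,n-1} β_{m,1}^{↑(n-1)}` for `m, n ≥ 1`. -/
def shuffle (k : Type u) [Field k] : (m n : ℕ) → MonoidAlgebra k (BraidGroup (m + n))
  | 0, _ => 1
  | _ + 1, 0 => 1
  | m + 1, n + 1 =>
      up 0 (shuffle k m (n + 1)) + up 0 (shuffle k (m + 1) n) * up n (beta k (m + 1) 1)
termination_by m n => m + n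

/-- The braid Pochhammer symbol
`P_{a,n}(x,y) = (x - β_{a,1} y)(x - β_{a+1,1} y) ⋯ (x - β_{a+n-1,1} y) ∈ 𝕜B_{a+n}`. -/
def pochhammer {k : Type u} [Field k] (a n : ℕ) (x y : k) :
    MonoidAlgebra k (BraidGroup (a + n)) :=
  ((List.range n).map fun i =>
    algebraMap k _ x - y • (up 0 (beta k (a + i) 1) : MonoidAlgebra k (BraidGroup (a + n)))).prod

/-- The elements `A^{a,b}_c = q^{1-a-c} Ш_{b-c,c}^{↑a} β_{a,c} p_{a,b-c}^{↑c} ∈ 𝕜B_{a+b}`, where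
`p_{a,b} = P_{a,b}(1, q^{-2})`. For `c > b` they vanish, since `Ш_{b-c,c} = 0` by convention when
`b - c < 0`. -/
def solution {k : Type u} [Field k] (q : kˣ) (a b c : ℕ) :
    MonoidAlgebra k (BraidGroup (a + b)) :=
  if c ≤ b then
    ((q ^ (1 - (a : ℤ) - (c : ℤ)) : kˣ) : k) •
      (up a (shuffle k (b - c) c) * up 0 (beta k a c) *
        up c (pochhammer a (b - c) 1 ((q ^ (-2 : ℤ) : kˣ) : k)))
  else 0

/-- The block-triangular Yang--Baxter system on the universal level: a family
`A^{a,b}_c ∈ 𝕜B_{a+b}` with `A^{a,b}_c = 0` for `c > b` such that, in `𝕜B_{a+b+c}`,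
`∑_i (A^{b,c}_i)^{↑a} A^{a,i}_e (A^{a+i-e,b+c-i}_f)^{↑e}
  = ∑_j A^{a,b}_j (A^{a+b-j,c}_{f+e-j})^{↑j} A^{j,f+e-j}_e`,
where `e ≤ i ≤ min(c, b+c-f)` and `max(0, f+e-c) ≤ j ≤ min(f, b)`. -/
def IsUniversalSolution {k : Type u} [Field k]
    (A : (a b : ℕ) → ℕ → MonoidAlgebra k (BraidGroup (a + b))) : Prop :=
  (∀ a b c : ℕ, b < c → A a b c = 0) ∧
  ∀ a b c e f : ℕ,
    (∑ i ∈ Finset.Icc e c with i + f ≤ b + c,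
      (up a (A b c i) * up 0 (A a i e) * up e (A (a + i - e) (b + c - i) f) :
        MonoidAlgebra k (BraidGroup (a + b + c)))) =
    ∑ j ∈ Finset.Icc 0 (min f b) with f + e ≤ j + c,
      (up 0 (A a b j) * up j (A (a + b - j) c (f + e - j)) * up 0 (A j (f + e - j) e) :
        MonoidAlgebra k (BraidGroup (a + b + c)))

/-! ### Braided vector spaces -/

section Braiding

variable {k : Type u} [Field k] {W : Type v} [AddCommGroup W] [Module k W]

/-- `R` acting on the factors number 1 and 2 of `W ⊗ W ⊗ W`. -/
def act12 (R : Module.End k (W ⊗[k] W)) : Module.End k (W ⊗[k] (W ⊗[k] W)) :=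
  (TensorProduct.assoc k W W W).conj (R.rTensor W)

/-- `R` acting on the factors number 2 and 3 of `W ⊗ W ⊗ W`. -/
def act23 (R : Module.End k (W ⊗[k] W)) : Module.End k (W ⊗[k] (W ⊗[k] W)) :=
  R.lTensor W

/-- A braiding on `W`: an invertible solution `R ∈ End(W ⊗ W)` of the Yang--Baxter equation
`R₁₂ R₂₃ R₁₂ = R₂₃ R₁₂ R₂₃`. -/
def IsBraiding (R : Module.End k (W ⊗[k] W)) : Prop :=
  IsUnit R ∧ act12 R * act23 R * act12 R = act23 R * act12 R * act23 R

theorem IsBraiding.smul {R : Module.End k (W ⊗[k] W)} (hR : IsBraiding R) (q : kˣ) :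
    IsBraiding ((q : k) • R) := by
  obtain ⟨hu, hyb⟩ := hR
  have h12 : act12 ((q : k) • R) = (q : k) • act12 R := by simp [act12, LinearMap.rTensor_smul]
  have h23 : act23 ((q : k) • R) = (q : k) • act23 R := by simp [act23, LinearMap.lTensor_smul]
  refine ⟨?_, ?_⟩
  · have := hu.smul q
    simpa [Units.smul_def] using this
  · rw [h12, h23]
    simp only [smul_mul_assoc, mul_smul_comm, hyb]

end Braiding

/-! ### The local representation -/

section LocalRep

variable {k : Type u} [Field k] {V : Type v} [AddCommGroup V] [Module k V] {n : ℕ}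

open Function

/-- The linear map `V ⊗ V → V^{⊗n}` which places `x ⊗ y` into the positions `i ≠ j` of the
decomposable tensor of the vectors `v`. -/
def insertPair (v : Fin n → V) (i j : Fin n) (hij : i ≠ j) :
    V ⊗[k] V →ₗ[k] ⨂[k]^n V :=
  TensorProduct.lift (LinearMap.mk₂ k
    (fun x y => PiTensorProduct.tprod k (update (update v i x) j y))
    (fun x x' y => by simp only [update_comm hij, MultilinearMap.map_update_add])
    (fun c x y => by simp only [update_comm hij, MultilinearMap.map_update_smul])
    (fun x y y' => by simp only [MultilinearMap.map_update_add])
    (fun c x y => by simp only [MultilinearMap.map_update_smul]))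

@[simp]
theorem insertPair_tmul (v : Fin n → V) (i j : Fin n) (hij : i ≠ j) (x y : V) :
    insertPair v i j hij (x ⊗ₜ[k] y) =
      PiTensorProduct.tprod k (update (update v i x) j y) := rfl

/-- Places `x ⊗ y ⊗ z` into the distinct positions `i`, `j`, `l`. -/
def insertTriple (v : Fin n → V) (i j l : Fin n) (hij : i ≠ j) (hil : i ≠ l) (hjl : j ≠ l) :
    V ⊗[k] (V ⊗[k] V) →ₗ[k] ⨂[k]^n V :=
  TensorProduct.lift
    { toFun := fun x => insertPair (update v i x) j l hjl
      map_add' := fun x x' => by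
        refine TensorProduct.ext' fun y z => ?_
        simp [update_comm hij, update_comm hil]
      map_smul' := fun c x => by
        refine TensorProduct.ext' fun y z => ?_
        simp [update_comm hij, update_comm hil] }

theorem insertTriple_tmul (v : Fin n → V) (i j l : Fin n) (hij : i ≠ j) (hil : i ≠ l)
    (hjl : j ≠ l) (x : V) (t : V ⊗[k] V) :
    insertTriple v i j l hij hil hjl (x ⊗ₜ[k] t) = insertPair (update v i x) j l hjl t := rfl

/-- The operator on `V^{⊗n}` which acts as `R` on the copies number `i ≠ j` of `V` and as the
identity on the other copies. -/
def twoSite (i j : Fin n) (hij : i ≠ j) (R : Module.End k (V ⊗[k] V)) :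
    Module.End k (⨂[k]^n V) :=
  PiTensorProduct.lift (MultilinearMap.mk' (fun v => insertPair v i j hij (R (v i ⊗ₜ[k] v j)))
    (fun v l x y => by
      by_cases hi : l = i
      · subst hi
        have h : ∀ z, insertPair (k := k) (update v l z) l j hij = insertPair v l j hij :=
          fun z => TensorProduct.ext' fun a b => by simp
        simp [h, hij.symm, TensorProduct.add_tmul]
      by_cases hj : l = j
      · subst hj
        have h : ∀ z, insertPair (k := k) (update v l z) i l hij = insertPair v i l hij :=
          fun z => TensorProduct.ext' fun a b => by simp [update_comm hi]
        simp [h, hij, TensorProduct.tmul_add]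
      · have h : insertPair (k := k) (update v l (x + y)) i j hij =
            insertPair (update v l x) i j hij + insertPair (update v l y) i j hij :=
          TensorProduct.ext' fun a b => by simp [update_comm hi, update_comm hj]
        simp [h, Ne.symm hi, Ne.symm hj])
    (fun v l c x => by
      by_cases hi : l = i
      · subst hi
        have h : ∀ z, insertPair (k := k) (update v l z) l j hij = insertPair v l j hij :=
          fun z => TensorProduct.ext' fun a b => by simp
        simp [h, hij.symm, ← TensorProduct.smul_tmul']
      by_cases hj : l = j
      · subst hj
        have h : ∀ z, insertPair (k := k) (update v l z) i l hij = insertPair v i l hij :=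
          fun z => TensorProduct.ext' fun a b => by simp [update_comm hi]
        simp [h, hij]
      · have h : insertPair (k := k) (update v l (c • x)) i j hij =
            c • insertPair (update v l x) i j hij :=
          TensorProduct.ext' fun a b => by simp [update_comm hi, update_comm hj]
        simp [h, Ne.symm hi, Ne.symm hj]))

theorem twoSite_tprod (i j : Fin n) (hij : i ≠ j) (R : Module.End k (V ⊗[k] V)) (v : Fin n → V) :
    twoSite i j hij R (PiTensorProduct.tprod k v) = insertPair v i j hij (R (v i ⊗ₜ[k] v j)) := by
  simp [twoSite]

theorem twoSite_insertPair (i j : Fin n) (hij : i ≠ j) (R : Module.End k (V ⊗[k] V))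
    (v : Fin n → V) (t : V ⊗[k] V) :
    twoSite i j hij R (insertPair v i j hij t) = insertPair v i j hij (R t) := by
  suffices h : twoSite i j hij R ∘ₗ insertPair v i j hij = insertPair v i j hij ∘ₗ R from
    LinearMap.congr_fun h t
  refine TensorProduct.ext' fun x y => ?_
  have h : insertPair (k := k) (update (update v i x) j y) i j hij = insertPair v i j hij :=
    TensorProduct.ext' fun a b => by simp [update_comm hij]
  simp [twoSite_tprod, h, hij]

theorem twoSite_one (i j : Fin n) (hij : i ≠ j) :
    twoSite i j hij (1 : Module.End k (V ⊗[k] V)) = 1 := by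
  refine PiTensorProduct.ext (MultilinearMap.ext fun v => ?_)
  simp [twoSite_tprod]

theorem twoSite_mul (i j : Fin n) (hij : i ≠ j) (R S : Module.End k (V ⊗[k] V)) :
    twoSite i j hij (R * S) = twoSite i j hij R * twoSite i j hij S := by
  refine PiTensorProduct.ext (MultilinearMap.ext fun v => ?_)
  simp [twoSite_tprod, twoSite_insertPair]

/-- Places two elements of `V ⊗ V` into the disjoint pairs of positions `(i, j)` and `(l, m)`. -/
def insertTwoPairs (v : Fin n → V) (i j l m : Fin n) (hij : i ≠ j) (hlm : l ≠ m) (hil : i ≠ l)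
    (him : i ≠ m) (hjl : j ≠ l) (hjm : j ≠ m) :
    V ⊗[k] V →ₗ[k] V ⊗[k] V →ₗ[k] ⨂[k]^n V :=
  TensorProduct.lift (LinearMap.mk₂ k (fun x y => insertPair (update (update v i x) j y) l m hlm)
    (fun x x' y => TensorProduct.ext' fun a b => by
      simp [update_comm hij, update_comm hil, update_comm him])
    (fun c x y => TensorProduct.ext' fun a b => by
      simp [update_comm hij, update_comm hil, update_comm him])
    (fun x y y' => TensorProduct.ext' fun a b => by
      simp [update_comm hjl, update_comm hjm])
    (fun c x y => TensorProduct.ext' fun a b => by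
      simp [update_comm hjl, update_comm hjm]))

theorem insertTwoPairs_tmul (v : Fin n → V) (i j l m : Fin n) (hij : i ≠ j) (hlm : l ≠ m)
    (hil : i ≠ l) (him : i ≠ m) (hjl : j ≠ l) (hjm : j ≠ m) (x y : V) :
    insertTwoPairs (k := k) v i j l m hij hlm hil him hjl hjm (x ⊗ₜ[k] y) =
      insertPair (update (update v i x) j y) l m hlm := rfl

theorem insertTwoPairs_comm (v : Fin n → V) (i j l m : Fin n) (hij : i ≠ j) (hlm : l ≠ m)
    (hil : i ≠ l) (him : i ≠ m) (hjl : j ≠ l) (hjm : j ≠ m) (s t : V ⊗[k] V) :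
    insertTwoPairs v i j l m hij hlm hil him hjl hjm s t =
      insertTwoPairs v l m i j hlm hij hil.symm hjl.symm him.symm hjm.symm t s := by
  suffices h : insertTwoPairs (k := k) v i j l m hij hlm hil him hjl hjm =
      (insertTwoPairs v l m i j hlm hij hil.symm hjl.symm him.symm hjm.symm).flip by
    rw [h, LinearMap.flip_apply]
  refine TensorProduct.ext' fun x y => TensorProduct.ext' fun z w => ?_
  simp only [LinearMap.flip_apply, insertTwoPairs_tmul, insertPair_tmul]
  congr 1
  rw [update_comm hjl, update_comm hil, update_comm hjm, update_comm him]

theorem twoSite_insertPair_of_disjoint (v : Fin n → V) (i j l m : Fin n) (hij : i ≠ j)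
    (hlm : l ≠ m) (hil : i ≠ l) (him : i ≠ m) (hjl : j ≠ l) (hjm : j ≠ m)
    (R : Module.End k (V ⊗[k] V)) (s : V ⊗[k] V) :
    twoSite l m hlm R (insertPair v i j hij s) =
      insertTwoPairs v i j l m hij hlm hil him hjl hjm s (R (v l ⊗ₜ[k] v m)) := by
  suffices h : twoSite l m hlm R ∘ₗ insertPair v i j hij =
      (insertTwoPairs v i j l m hij hlm hil him hjl hjm).flip (R (v l ⊗ₜ[k] v m)) from
    LinearMap.congr_fun h s
  refine TensorProduct.ext' fun x y => ?_
  simp [twoSite_tprod, insertTwoPairs_tmul, hil.symm, hjl.symm, him.symm, hjm.symm]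

theorem twoSite_comm (i j l m : Fin n) (hij : i ≠ j) (hlm : l ≠ m) (hil : i ≠ l) (him : i ≠ m)
    (hjl : j ≠ l) (hjm : j ≠ m) (R S : Module.End k (V ⊗[k] V)) :
    twoSite i j hij R * twoSite l m hlm S = twoSite l m hlm S * twoSite i j hij R := by
  refine PiTensorProduct.ext (MultilinearMap.ext fun v => ?_)
  simp only [LinearMap.compMultilinearMap_apply, Module.End.mul_apply, twoSite_tprod]
  rw [twoSite_insertPair_of_disjoint v l m i j hlm hij hil.symm hjl.symm him.symm hjm.symm,
    twoSite_insertPair_of_disjoint v i j l m hij hlm hil him hjl hjm, insertTwoPairs_comm]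

theorem twoSite_insertTriple_12 (v : Fin n → V) (i j l : Fin n) (hij : i ≠ j) (hil : i ≠ l)
    (hjl : j ≠ l) (R : Module.End k (V ⊗[k] V)) (t : V ⊗[k] (V ⊗[k] V)) :
    twoSite i j hij R (insertTriple v i j l hij hil hjl t) =
      insertTriple v i j l hij hil hjl (act12 R t) := by
  suffices h : (twoSite i j hij R ∘ₗ insertTriple v i j l hij hil hjl) ∘ₗ
        (TensorProduct.assoc k V V V).toLinearMap =
      (insertTriple v i j l hij hil hjl ∘ₗ (TensorProduct.assoc k V V V).toLinearMap) ∘ₗ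
        R.rTensor V by
    have := LinearMap.congr_fun h ((TensorProduct.assoc k V V V).symm t)
    simpa [act12, LinearEquiv.conj_apply] using this
  refine TensorProduct.ext' fun s z => ?_
  have h1 : ∀ s : V ⊗[k] V, insertTriple v i j l hij hil hjl
      (TensorProduct.assoc k V V V (s ⊗ₜ[k] z)) = insertPair (update v l z) i j hij s := by
    intro s
    suffices h : (insertTriple v i j l hij hil hjl ∘ₗ (TensorProduct.assoc k V V V).toLinearMap) ∘ₗ
        (TensorProduct.mk k (V ⊗[k] V) V).flip z = insertPair (update v l z) i j hij from
      LinearMap.congr_fun h s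
    refine TensorProduct.ext' fun x y => ?_
    simp [insertTriple_tmul, update_comm hil, update_comm hjl]
  simp [h1, twoSite_insertPair]

theorem twoSite_insertTriple_23 (v : Fin n → V) (i j l : Fin n) (hij : i ≠ j) (hil : i ≠ l)
    (hjl : j ≠ l) (R : Module.End k (V ⊗[k] V)) (t : V ⊗[k] (V ⊗[k] V)) :
    twoSite j l hjl R (insertTriple v i j l hij hil hjl t) =
      insertTriple v i j l hij hil hjl (act23 R t) := by
  suffices h : twoSite j l hjl R ∘ₗ insertTriple v i j l hij hil hjl =
      insertTriple v i j l hij hil hjl ∘ₗ act23 R from LinearMap.congr_fun h t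
  refine TensorProduct.ext' fun x s => ?_
  simp [act23, insertTriple_tmul, twoSite_insertPair]

theorem twoSite_braid (i j l : Fin n) (hij : i ≠ j) (hil : i ≠ l) (hjl : j ≠ l)
    (R : Module.End k (V ⊗[k] V)) (hR : IsBraiding R) :
    twoSite i j hij R * twoSite j l hjl R * twoSite i j hij R =
      twoSite j l hjl R * twoSite i j hij R * twoSite j l hjl R := by
  refine PiTensorProduct.ext (MultilinearMap.ext fun v => ?_)
  have h : PiTensorProduct.tprod k v =
      insertTriple v i j l hij hil hjl (v i ⊗ₜ[k] (v j ⊗ₜ[k] v l)) := by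
    simp [insertTriple_tmul]
  have hyb := LinearMap.congr_fun hR.2 (v i ⊗ₜ[k] (v j ⊗ₜ[k] v l))
  simp only [Module.End.mul_apply] at hyb
  simp only [LinearMap.compMultilinearMap_apply, Module.End.mul_apply, h, twoSite_insertTriple_12,
    twoSite_insertTriple_23, hyb]

/-- The operator `R` acting on the copies number `i` and `j`, as a homomorphism from `End(V ⊗ V)`
to `End(V^{⊗n})`. -/
def twoSiteHom (i j : Fin n) (hij : i ≠ j) :
    Module.End k (V ⊗[k] V) →* Module.End k (⨂[k]^n V) where
  toFun := twoSite i j hij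
  map_one' := twoSite_one i j hij
  map_mul' := twoSite_mul i j hij

/-- The invertible operator `R_i = 1^{⊗ i} ⊗ R ⊗ 1^{⊗ (n-i-2)}` on `V^{⊗n}` acting as `R` on the
copies number `i`, `i + 1` (counted from `0`) of `V`. Out of the range `i < n - 1` it is set to `1`,
which is never used. -/
def siteUnit (R : Module.End k (V ⊗[k] V)) (hR : IsBraiding R) (n i : ℕ) :
    (Module.End k (⨂[k]^n V))ˣ :=
  if h : i < n - 1 then
    Units.map (twoSiteHom (⟨i, by omega⟩ : Fin n) ⟨i + 1, by omega⟩ (by simp)) hR.1.unit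
  else 1

/-- The local representation `ρ_R : B_n → Aut(V^{⊗n})` of a braiding `R` on `V`, sending each
Artin generator `σ_i` to `R_i`. -/
def localRep (R : Module.End k (V ⊗[k] V)) (hR : IsBraiding R) (n : ℕ) :
    BraidGroup n →* (Module.End k (⨂[k]^n V))ˣ :=
  liftBraid n (siteUnit R hR n)
    (fun i hi => by
      have hi' : i < n - 1 := by omega
      ext1
      simp only [siteUnit, dif_pos hi, dif_pos hi', Units.val_mul, Units.coe_map, IsUnit.unit_spec]
      exact twoSite_braid _ _ _ _ (by simp; omega) _ R hR)
    (fun i j hij hj => by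
      have hi' : i < n - 1 := by omega
      ext1
      simp only [siteUnit, dif_pos hj, dif_pos hi', Units.val_mul, Units.coe_map, IsUnit.unit_spec]
      exact twoSite_comm _ _ _ _ _ _ (by simp; omega) (by simp; omega) (by simp; omega)
        (by simp; omega) R R)

/-- The extension of the local representation `ρ_R` to the group algebra `𝕜B_n`. -/
def localRepAlg (R : Module.End k (V ⊗[k] V)) (hR : IsBraiding R) (n : ℕ) :
    MonoidAlgebra k (BraidGroup n) →ₐ[k] Module.End k (⨂[k]^n V) :=
  MonoidAlgebra.lift k _ (BraidGroup n) ((Units.coeHom _).comp (localRep R hR n))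

end LocalRep

/-! ### The braiding of tensor spaces -/

section TensorSpace

variable {k : Type u} [Field k]

/-- The tensor space `T(V) = ⨁_n V^{⊗n}`. -/
abbrev TensorSpace (k : Type u) [Field k] (V : Type v) [AddCommGroup V] [Module k V] :
    Type (max u v) :=
  ⨁ n : ℕ, ⨂[k]^n V

/-- The map `T(f) : T(V) → T(V')` whose restriction to `V^{⊗n}` is `f ⊗ ⋯ ⊗ f`. -/
def tensorMap {V : Type v} [AddCommGroup V] [Module k V] {V' : Type w} [AddCommGroup V']
    [Module k V'] (f : V →ₗ[k] V') : TensorSpace k V →ₗ[k] TensorSpace k V' :=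
  DirectSum.lmap fun n : ℕ => (PiTensorProduct.map fun _ : Fin n => f)

variable {V : Type v} [AddCommGroup V] [Module k V]

/-- An operator `X` on `V^{⊗(b+c)}`, regarded as an operator from `V^{⊗m} ⊗ V^{⊗l}` to
`V^{⊗b} ⊗ V^{⊗c}`, where `m + l = b + c`, by means of the canonical isomorphisms
`V^{⊗m} ⊗ V^{⊗l} = V^{⊗(m+l)} = V^{⊗(b+c)} = V^{⊗b} ⊗ V^{⊗c}`. -/
def block {m l b c : ℕ} (h : m + l = b + c) (X : Module.End k (⨂[k]^(b + c) V)) :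
    (⨂[k]^m V) ⊗[k] (⨂[k]^l V) →ₗ[k] (⨂[k]^b V) ⊗[k] (⨂[k]^c V) :=
  TensorPower.mulEquiv.symm.toLinearMap ∘ₗ X ∘ₗ (TensorPower.cast k V h).toLinearMap ∘ₗ
    TensorPower.mulEquiv.toLinearMap

/-- The operator on `T(V) ⊗ T(V)` obtained from a family `A^{b,c}_m ∈ 𝕜B_{b+c}` through the local
representation of a braiding `S` on `V`: it is the operator whose matrix block from
`V^{⊗m} ⊗ V^{⊗l}` to `V^{⊗b} ⊗ V^{⊗c}` is `ρ_S(A^{b,c}_m)` if `b + c = m + l`, and zero otherwise.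
In other words, it is the operator for which the exchange rule of `x ∈ V^{⊗b}` and `y ∈ V^{⊗c}` is
`x^{[b]} y^{[c]} = ∑_m A^{b,c}_m y^{[m]} x^{[b+c-m]}`. -/
def tensorOperator (A : (a b : ℕ) → ℕ → MonoidAlgebra k (BraidGroup (a + b)))
    (S : Module.End k (V ⊗[k] V)) (hS : IsBraiding S) :
    Module.End k (TensorSpace k V ⊗[k] TensorSpace k V) :=
  (DirectSum.toModule k (ℕ × ℕ) (TensorSpace k V ⊗[k] TensorSpace k V) fun p =>
    ∑ r : {r : ℕ × ℕ // r ∈ Finset.HasAntidiagonal.antidiagonal (p.1 + p.2)},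
      TensorProduct.map (DirectSum.lof k ℕ (fun n => ⨂[k]^n V) r.1.1)
          (DirectSum.lof k ℕ (fun n => ⨂[k]^n V) r.1.2) ∘ₗ
        block (Finset.HasAntidiagonal.mem_antidiagonal.mp r.2).symm
          (localRepAlg S hS (r.1.1 + r.1.2) (A r.1.1 r.1.2 p.1))) ∘ₗ
  (TensorProduct.directSum k k (fun n : ℕ => ⨂[k]^n V) (fun n : ℕ => ⨂[k]^n V)).toLinearMap

/-- The operator `T(R)` on `T(V) ⊗ T(V)`: the image of the universal elements `A^{a,b}_c` under the
local representation `ρ_{qR}`. -/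
def tensorBraiding (q : kˣ) (R : Module.End k (V ⊗[k] V)) (hR : IsBraiding R) :
    Module.End k (TensorSpace k V ⊗[k] TensorSpace k V) :=
  tensorOperator (solution q) ((q : k) • R) (hR.smul q)

end TensorSpace

end BraidTensor

end

open scoped TensorProduct DirectSum

noncomputable section

namespace BraidTensor

universe u v w

/-! ### Shuffle and Pochhammer elements for a sequence satisfying the braid relations -/

/-! The Yang–Baxter system is reduced to one identity between shuffle elements and Pochhammer
symbols. Each summand of either side can be rearranged into $Ш_{C,e}^{\uparrow
a+b}\,\beta_{b,e}^{\uparrow a}\,(\cdots)^{\uparrow a+e}\,\beta_{a,e+f}\,P_{a,h}^{\uparrow e+f}$ with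
$C=c-e$ and $h=b+C-f$, where only the middle factor depends on the summation index (`left_term_eq`,
`right_term_eq`). Three tools suffice: elements on disjoint strands commute, an element slides
through $\beta_{a,b}$ with its shift changed (`betaSeq_mul_left`, `betaSeq_mul_right`), and shuffles
are associative (`shuffleSeq_assoc`). The powers of $q$ multiply to the same scalar on both sides,
except for an extra $q^{-2g}$ in the left summand $i=e+g$; this is why the Pochhammer parameter is
$t=q^{-2}$.

The sums of the middle factors are `ydRight` and `ydLeft`, and the remaining claim is
`ydLeft_eq_ydRight`. It holds by induction on $c$, because both sides satisfy
$X_{f,h,c+1}=X_{f,h-1,c}+X_{f-1,h,c}\,\beta_{h,1}^{\uparrow f-1}(1-t\beta_{f-1,1})$ (`ydLeft_succ`,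
`ydRight_succ`). On the right the recursion comes from a cancellation between neighbouring values of
$g$, supplied by `pochFactor_mul_shuffleSeq`.

All of this takes place in one algebra with a sequence `s` obeying the braid relations, elements
being functions of the shift; no transport between different group algebras is then needed.
`up_solution` carries the result back to $\Bbbk B_{a+b+c}$.

For the operator on $T(V)$, tensoring with a fixed tensor intertwines $w$ with its shift
(`localRepAlg_up_place`). On each summand of $T(V)^{\otimes3}$, comparing the components of the two
triple products is therefore the universal system itself. Invertibility is triangularity:
$V^{\otimes n-b}\otimes V^{\otimes b}$ reaches only those $V^{\otimes i}\otimes V^{\otimes n-i}$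
with $i\le b$, and the block $i=b$ is a nonzero multiple of a braid. Functoriality holds because
$f^{\otimes n}$ intertwines the generators, hence the whole group algebra. -/

theorem mul_eq_mul_reassoc {M : Type*} [Semigroup M] {x y z w : M} (h : x * y = z * w) (v : M) :
    x * (y * v) = z * (w * v) := by
  rw [← mul_assoc, h, mul_assoc]

theorem mul_eq_reassoc {M : Type*} [Semigroup M] {x y z : M} (h : x * y = z) (v : M) :
    x * (y * v) = z * v := by
  rw [← mul_assoc, h]

/-- A sequence satisfying the relations of the infinite braid monoid. -/
structure IsBraidSeq {A : Type*} [Mul A] (s : ℕ → A) : Prop where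
  braid : ∀ i, s i * s (i + 1) * s i = s (i + 1) * s i * s (i + 1)
  comm : ∀ i j, i + 1 < j → s i * s j = s j * s i

section Seq

variable {k : Type*} [CommRing k] {A : Type*} [Ring A] [Algebra k A]

/-- Elements which only involve `n` strands, viewed as functions of the shift: the algebra
generated by the functions `l ↦ s (i + l)` with `i + 1 < n`. -/
def strandAlg (k : Type*) [CommRing k] {A : Type*} [Ring A] [Algebra k A] (s : ℕ → A) (n : ℕ) :
    Subalgebra k (ℕ → A) :=
  Algebra.adjoin k {f | ∃ i, i + 1 < n ∧ f = fun l => s (i + l)}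

theorem gen_mem_strandAlg (s : ℕ → A) {i n : ℕ} (h : i + 1 < n) :
    (fun l => s (i + l)) ∈ strandAlg k s n :=
  Algebra.subset_adjoin ⟨i, h, rfl⟩

theorem strandAlg_shift {s : ℕ → A} {n m : ℕ} (d : ℕ) (h : n + d ≤ m) {f : ℕ → A}
    (hf : f ∈ strandAlg k s n) : (fun l => f (l + d)) ∈ strandAlg k s m := by
  induction hf using Algebra.adjoin_induction with
  | mem f hf =>
    obtain ⟨i, hi, rfl⟩ := hf
    have := gen_mem_strandAlg (k := k) s (i := i + d) (n := m) (by omega)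
    convert this using 3
    omega
  | algebraMap r => exact (strandAlg k s m).algebraMap_mem r
  | add f g _ _ hf hg => exact add_mem hf hg
  | mul f g _ _ hf hg => exact mul_mem hf hg

theorem strandAlg_mono {s : ℕ → A} {n m : ℕ} (h : n ≤ m) {f : ℕ → A}
    (hf : f ∈ strandAlg k s n) : f ∈ strandAlg k s m :=
  strandAlg_shift 0 h hf

/-- Far commutativity: `f l` involves the strands from `l` to `l + n - 1`, which all lie before
those of `g l'`. -/
theorem IsBraidSeq.commute {s : ℕ → A} (hs : IsBraidSeq s) {n m : ℕ} {f g : ℕ → A}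
    (hf : f ∈ strandAlg k s n) (hg : g ∈ strandAlg k s m) {l l' : ℕ} (h : l + n ≤ l') :
    Commute (f l) (g l') := by
  induction hf using Algebra.adjoin_induction with
  | mem f hf =>
    obtain ⟨i, hi, rfl⟩ := hf
    induction hg using Algebra.adjoin_induction with
    | mem g hg =>
      obtain ⟨j, hj, rfl⟩ := hg
      exact hs.comm _ _ (by omega)
    | algebraMap r => exact (Algebra.commutes r _).symm
    | add f g _ _ hf hg => exact hf.add_right hg
    | mul f g _ _ hf hg => exact hf.mul_right hg
  | algebraMap r => exact Algebra.commutes r _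
  | add f g _ _ hf hg => exact hf.add_left hg
  | mul f g _ _ hf hg => exact hf.mul_left hg

/-! ### The elements β, Ш and P as functions of the shift, and the strands they involve -/

/-- The braid `β_{1,b}` with shift `l`. -/
def rowSeq (s : ℕ → A) : ℕ → ℕ → A
  | 0, _ => 1
  | b + 1, l => rowSeq s b l * s (b + l)

/-- The braid `β_{a,b}` with shift `l`. -/
def betaSeq (s : ℕ → A) : ℕ → ℕ → ℕ → A
  | 0, _, _ => 1
  | a + 1, b, l => rowSeq s b (l + a) * betaSeq s a b l

/-- The shuffle element `Ш_{m,n}` with shift `l`. -/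
def shuffleSeq (s : ℕ → A) : ℕ → ℕ → ℕ → A
  | 0, _, _ => 1
  | _ + 1, 0, _ => 1
  | m + 1, n + 1, l =>
    shuffleSeq s m (n + 1) l + shuffleSeq s (m + 1) n l * betaSeq s (m + 1) 1 (l + n)

/-- The Pochhammer symbol `P_{a,n}(1,t)` with shift `l`. -/
def pochSeq (s : ℕ → A) (t : k) (a : ℕ) : ℕ → ℕ → A
  | 0, _ => 1
  | n + 1, l => pochSeq s t a n l * (1 - t • betaSeq s (a + n) 1 l)

theorem rowSeq_mem (s : ℕ → A) (b : ℕ) : rowSeq s b ∈ strandAlg k s (b + 1) := by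
  induction b with
  | zero => exact one_mem _
  | succ b ih =>
    exact mul_mem (strandAlg_mono (by omega) ih) (gen_mem_strandAlg s (by omega))

theorem betaSeq_mem (s : ℕ → A) (a b : ℕ) : betaSeq s a b ∈ strandAlg k s (a + b) := by
  induction a with
  | zero => exact one_mem _
  | succ a ih =>
    exact mul_mem (strandAlg_shift a (by omega) (rowSeq_mem s b)) (strandAlg_mono (by omega) ih)

theorem shuffleSeq_mem (s : ℕ → A) (m n : ℕ) : shuffleSeq s m n ∈ strandAlg k s (m + n) := by
  suffices H : ∀ N m n, m + n = N → shuffleSeq s m n ∈ strandAlg k s (m + n) from H _ _ _ rfl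
  intro N
  induction N with
  | zero =>
    intro m n h
    obtain rfl : m = 0 := by omega
    rw [show shuffleSeq s 0 n = 1 by ext l; simp [shuffleSeq]]
    exact one_mem _
  | succ N ih =>
    intro m n h
    match m, n with
    | 0, n =>
      rw [show shuffleSeq s 0 n = 1 by ext l; simp [shuffleSeq]]
      exact one_mem _
    | m + 1, 0 =>
      rw [show shuffleSeq s (m + 1) 0 = 1 by ext l; simp [shuffleSeq]]
      exact one_mem _
    | m + 1, n + 1 =>
      have : shuffleSeq s (m + 1) (n + 1) = shuffleSeq s m (n + 1) +
          shuffleSeq s (m + 1) n * fun l => betaSeq s (m + 1) 1 (l + n) := by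
        ext l; simp [shuffleSeq]
      rw [this]
      exact add_mem (strandAlg_mono (by omega) (ih m (n + 1) (by omega)))
        (mul_mem (strandAlg_mono (by omega) (ih (m + 1) n (by omega)))
          (strandAlg_shift n (by omega) (betaSeq_mem s (m + 1) 1)))

theorem pochFactor_mem (s : ℕ → A) (t : k) (a : ℕ) :
    (fun l => 1 - t • betaSeq s a 1 l) ∈ strandAlg k s (a + 1) :=
  sub_mem (one_mem _) (Subalgebra.smul_mem _ (betaSeq_mem s a 1) t)

theorem pochSeq_mem (s : ℕ → A) (t : k) (a n : ℕ) : pochSeq s t a n ∈ strandAlg k s (a + n) := by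
  induction n with
  | zero => exact one_mem _
  | succ n ih => exact mul_mem (strandAlg_mono (by omega) ih) (pochFactor_mem s t (a + n))

/-! ### Boundary values, additivity in the indices, and sliding through β -/

@[simp] theorem rowSeq_zero (s : ℕ → A) (l : ℕ) : rowSeq s 0 l = 1 := rfl

@[simp] theorem betaSeq_zero_left (s : ℕ → A) (b l : ℕ) : betaSeq s 0 b l = 1 := rfl

@[simp] theorem betaSeq_zero_right (s : ℕ → A) (a l : ℕ) : betaSeq s a 0 l = 1 := by
  induction a with
  | zero => rfl
  | succ a ih => simp [betaSeq, ih]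

@[simp] theorem shuffleSeq_zero_left (s : ℕ → A) (n l : ℕ) : shuffleSeq s 0 n l = 1 := by
  simp [shuffleSeq]

@[simp] theorem shuffleSeq_zero_right (s : ℕ → A) (n l : ℕ) : shuffleSeq s n 0 l = 1 := by
  cases n <;> simp [shuffleSeq]

@[simp] theorem pochSeq_zero (s : ℕ → A) (t : k) (a l : ℕ) : pochSeq s t a 0 l = 1 := rfl

theorem rowSeq_add (s : ℕ → A) (b b' l : ℕ) :
    rowSeq s (b + b') l = rowSeq s b l * rowSeq s b' (l + b) := by
  induction b' with
  | zero => simp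
  | succ n ih =>
    rw [← add_assoc, rowSeq, ih, rowSeq, mul_assoc, show b + n + l = n + (l + b) by omega]

theorem betaSeq_add_left (s : ℕ → A) (a a' b l : ℕ) :
    betaSeq s (a + a') b l = betaSeq s a' b (l + a) * betaSeq s a b l := by
  induction a' with
  | zero => simp
  | succ n ih => rw [← add_assoc, betaSeq, ih, betaSeq, mul_assoc, ← add_assoc]

theorem pochSeq_add (s : ℕ → A) (t : k) (a n m l : ℕ) :
    pochSeq s t a (n + m) l = pochSeq s t a n l * pochSeq s t (a + n) m l := by
  induction m with
  | zero => simp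
  | succ m ih => rw [← add_assoc, pochSeq, ih, pochSeq, mul_assoc, ← add_assoc]

theorem betaSeq_add_right {s : ℕ → A} (hs : IsBraidSeq s) (a b b' l : ℕ) :
    betaSeq s a (b + b') l = betaSeq s a b l * betaSeq s a b' (l + b) := by
  induction a with
  | zero => simp
  | succ a ih =>
    have h := hs.commute (betaSeq_mem (k := ℤ) s a b) (rowSeq_mem s b')
      (l := l) (l' := l + a + b) (by omega)
    rw [betaSeq, ih, rowSeq_add, betaSeq, betaSeq, show l + b + a = l + a + b by omega]
    simp only [mul_assoc]
    rw [mul_eq_mul_reassoc h.eq]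

/-- A generator passes the later letters of the row by far commutativity, then is raised by one
braid relation when it meets its neighbour. -/
theorem rowSeq_mul_gen {s : ℕ → A} (hs : IsBraidSeq s) {b i : ℕ} (h : i + 1 < b) (l : ℕ) :
    rowSeq s b l * s (i + l) = s (i + 1 + l) * rowSeq s b l := by
  induction b with
  | zero => omega
  | succ b ih =>
    rw [rowSeq, mul_assoc]
    by_cases hi : i + 1 < b
    · rw [← hs.comm (i + l) (b + l) (by omega), ← mul_assoc, ih hi, mul_assoc]
    · obtain rfl : b = i + 1 := by omega
      have hc := hs.commute (rowSeq_mem (k := ℤ) s i) (gen_mem_strandAlg s (i := 0) (n := 2) (by omega))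
        (l := l) (l' := i + l + 1) (by omega)
      have hb := hs.braid (i + l)
      rw [show i + 1 + l = i + l + 1 by omega, rowSeq]
      simp only [zero_add] at hc
      rw [mul_assoc, ← mul_assoc (s (i + l)), hb]
      simp only [mul_assoc]
      rw [mul_eq_mul_reassoc hc.eq]

/-- Naturality of the block crossing: each of the `a` rows of $\beta_{a,b}$ raises a generator by
one. Generators suffice, since the relation is linear and multiplicative in `f`. -/
theorem betaSeq_mul_left {s : ℕ → A} (hs : IsBraidSeq s) {a b : ℕ} {f : ℕ → A}
    (hf : f ∈ strandAlg k s b) (l : ℕ) :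
    betaSeq s a b l * f l = f (l + a) * betaSeq s a b l := by
  induction hf using Algebra.adjoin_induction with
  | mem f hf =>
    obtain ⟨i, hi, rfl⟩ := hf
    dsimp only
    induction a with
    | zero => simp
    | succ a ih =>
      rw [betaSeq, mul_assoc, ih, ← mul_assoc, rowSeq_mul_gen hs hi, mul_assoc,
        show i + 1 + (l + a) = i + (l + (a + 1)) by omega]
  | algebraMap r => exact (Algebra.commutes r _).symm
  | add f g _ _ hf hg => simp only [Pi.add_apply, mul_add, add_mul, hf, hg]
  | mul f g _ _ hf hg =>
    simp only [Pi.mul_apply]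
    rw [← mul_assoc, hf, mul_assoc, hg, mul_assoc]

theorem betaSeq_one_mul_gen {s : ℕ → A} (hs : IsBraidSeq s) {a i : ℕ} (h : i + 1 < a) (l : ℕ) :
    betaSeq s a 1 l * s (i + 1 + l) = s (i + l) * betaSeq s a 1 l := by
  induction a with
  | zero => omega
  | succ a ih =>
    have hrow : ∀ m, rowSeq s 1 m = s m := fun m => by simp [rowSeq]
    rw [betaSeq, hrow]
    by_cases hi : i + 1 < a
    · rw [mul_assoc, ih hi, ← mul_assoc, ← mul_assoc, hs.comm (i + l) (l + a) (by omega)]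
    · obtain rfl : a = i + 1 := by omega
      have hc := hs.commute (betaSeq_mem (k := ℤ) s i 1)
        (gen_mem_strandAlg s (i := 0) (n := 2) (by omega)) (l := l) (l' := i + l + 1) (by omega)
      have hb := hs.braid (i + l)
      simp only [zero_add] at hc
      rw [betaSeq, hrow, show i + 1 + l = i + l + 1 by omega, show l + (i + 1) = i + l + 1 by omega,
        add_comm l i]
      simp only [mul_assoc] at hb ⊢
      rw [hc.eq, ← mul_assoc (s (i + l)), ← mul_assoc (s (i + l + 1)), ← hb]
      simp only [mul_assoc]

/-- The companion sliding rule for the other block: each of the `b` columns $\beta_{a,1}$ lowers a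
generator by one. -/
theorem betaSeq_mul_right {s : ℕ → A} (hs : IsBraidSeq s) {a b : ℕ} {f : ℕ → A}
    (hf : f ∈ strandAlg k s a) (l : ℕ) :
    betaSeq s a b l * f (l + b) = f l * betaSeq s a b l := by
  induction hf using Algebra.adjoin_induction with
  | mem f hf =>
    obtain ⟨i, hi, rfl⟩ := hf
    dsimp only
    induction b with
    | zero => simp
    | succ b ih =>
      rw [betaSeq_add_right hs, mul_assoc, show i + (l + (b + 1)) = i + 1 + (l + b) by omega,
        betaSeq_one_mul_gen hs hi, ← mul_assoc, ih, mul_assoc]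
  | algebraMap r => exact (Algebra.commutes r _).symm
  | add f g _ _ hf hg => simp only [Pi.add_apply, mul_add, add_mul, hf, hg]
  | mul f g _ _ hf hg =>
    simp only [Pi.mul_apply]
    rw [← mul_assoc, hf, mul_assoc, hg, mul_assoc]

/-! ### Shuffle identities -/

/-- The element `Ш_{m-1,n}`, which is zero for `m = 0`. -/
def shufflePredLeft (s : ℕ → A) : ℕ → ℕ → ℕ → A
  | 0, _, _ => 0
  | m + 1, n, l => shuffleSeq s m n l

/-- The element `Ш_{m,n-1}`, which is zero for `n = 0`. -/
def shufflePredRight (s : ℕ → A) : ℕ → ℕ → ℕ → A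
  | _, 0, _ => 0
  | m, n + 1, l => shuffleSeq s m n l

@[simp] theorem shufflePredLeft_zero (s : ℕ → A) (n l : ℕ) : shufflePredLeft s 0 n l = 0 := rfl

@[simp] theorem shufflePredLeft_succ (s : ℕ → A) (m n l : ℕ) :
    shufflePredLeft s (m + 1) n l = shuffleSeq s m n l := rfl

@[simp] theorem shufflePredRight_zero (s : ℕ → A) (m l : ℕ) : shufflePredRight s m 0 l = 0 := by
  simp [shufflePredRight]

@[simp] theorem shufflePredRight_succ (s : ℕ → A) (m n l : ℕ) :
    shufflePredRight s m (n + 1) l = shuffleSeq s m n l := by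
  simp [shufflePredRight]

theorem shuffleSeq_succ_succ (s : ℕ → A) (m n l : ℕ) :
    shuffleSeq s (m + 1) (n + 1) l =
      shuffleSeq s m (n + 1) l + shuffleSeq s (m + 1) n l * betaSeq s (m + 1) 1 (l + n) := by
  rw [shuffleSeq]

/-- The defining recursion, extended to the boundary by letting negative indices give zero. It fails
only for $Ш_{0,0}=1$. -/
theorem shuffleSeq_eq (s : ℕ → A) {m n : ℕ} (h : 0 < m + n) (l : ℕ) :
    shuffleSeq s m n l =
      shufflePredLeft s m n l + shufflePredRight s m n l * betaSeq s m 1 (l + (n - 1)) := by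
  match m, n with
  | 0, n + 1 => simp
  | m + 1, 0 => simp
  | m + 1, n + 1 => simp [shuffleSeq_succ_succ]

/-- The mirror recursion, which singles out the first strand rather than the last. Expanding by the
last strand and then, inductively, by the first gives four terms, which regroup the other way by the
defining recursion. -/
theorem shuffleSeq_eq' {s : ℕ → A} (hs : IsBraidSeq s) {m n : ℕ} (h : 0 < m + n) (l : ℕ) :
    shuffleSeq s m n l =
      shufflePredRight s m n (l + 1) + shufflePredLeft s m n (l + 1) * betaSeq s 1 n l := by
  suffices H : ∀ N m n, m + n = N + 1 → shuffleSeq s m n l =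
      shufflePredRight s m n (l + 1) + shufflePredLeft s m n (l + 1) * betaSeq s 1 n l from
    H (m + n - 1) m n (by omega)
  intro N
  induction N with
  | zero =>
    intro m n h
    obtain ⟨rfl, rfl⟩ | ⟨rfl, rfl⟩ : (m = 0 ∧ n = 1) ∨ (m = 1 ∧ n = 0) := by omega
    · simp
    · simp
  | succ N ih =>
    intro m n h
    match m, n with
    | 0, n + 1 => simp
    | m + 1, 0 => simp
    | m + 1, n + 1 =>
      have hc := hs.commute (betaSeq_mem (k := ℤ) s 1 n) (betaSeq_mem s m 1)
        (l := l) (l' := l + 1 + n) (by omega)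
      have h1 : betaSeq s (m + 1) 1 (l + n) = betaSeq s m 1 (l + 1 + n) * betaSeq s 1 1 (l + n) := by
        rw [add_comm m 1, betaSeq_add_left, show l + n + 1 = l + 1 + n by omega]
      have h2 : betaSeq s 1 (n + 1) l = betaSeq s 1 n l * betaSeq s 1 1 (l + n) :=
        betaSeq_add_right hs 1 n 1 l
      have h3 : betaSeq s 1 n l * betaSeq s (m + 1) 1 (l + n) =
          betaSeq s m 1 (l + 1 + n) * betaSeq s 1 (n + 1) l := by
        rw [h1, h2, ← mul_assoc, hc.eq, mul_assoc]
      rw [shuffleSeq, ih m (n + 1) (by omega), ih (m + 1) n (by omega)]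
      simp only [shufflePredLeft_succ, shufflePredRight_succ]
      rw [add_mul, mul_assoc, h3]
      -- Two of the four terms recombine into $Ш_{m+1,n}^{\uparrow1}$; the case `n = 0` is separate
      -- because `n - 1` is truncated in `shuffleSeq_eq`.
      have e1 : shufflePredRight s (m + 1) n (l + 1) * betaSeq s (m + 1) 1 (l + n) +
          shuffleSeq s m n (l + 1) = shuffleSeq s (m + 1) n (l + 1) := by
        cases n with
        | zero => simp
        | succ n =>
          rw [shuffleSeq_eq s (m := m + 1) (n := n + 1) (by omega) (l + 1), add_comm]
          simp [show l + (n + 1) = l + 1 + n by omega]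
      have e2 : shuffleSeq s m (n + 1) (l + 1) = shufflePredLeft s m (n + 1) (l + 1) +
          shuffleSeq s m n (l + 1) * betaSeq s m 1 (l + 1 + n) :=
        shuffleSeq_eq s (by omega) (l + 1)
      rw [← e1, e2]
      noncomm_ring

/-- Both sides describe shuffles of three blocks. When all blocks are nonempty, either side splits
into three terms according to the block whose length drops by one, so induction on the total length
applies. -/
theorem shuffleSeq_assoc {s : ℕ → A} (hs : IsBraidSeq s) (n m i l : ℕ) :
    shuffleSeq s n (i + m) l * shuffleSeq s m i l =
      shuffleSeq s (m + n) i l * shuffleSeq s n m (l + i) := by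
  suffices H : ∀ N n m i, n + m + i = N → shuffleSeq s n (i + m) l * shuffleSeq s m i l =
      shuffleSeq s (m + n) i l * shuffleSeq s n m (l + i) from H _ n m i rfl
  intro N
  induction N with
  | zero =>
    intro n m i h
    obtain ⟨rfl, rfl, rfl⟩ : n = 0 ∧ m = 0 ∧ i = 0 := by omega
    simp
  | succ N ih =>
    intro n m i h
    match n, m, i with
    | 0, _, _ => simp
    | _ + 1, 0, _ => simp
    | _ + 1, _ + 1, 0 => simp
    | n + 1, m + 1, i + 1 =>
      have ih1 := ih n (m + 1) (i + 1) (by omega)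
      have ih2 := ih (n + 1) m (i + 1) (by omega)
      have ih3 := ih (n + 1) (m + 1) i (by omega)
      have c1 := (hs.commute (shuffleSeq_mem (k := ℤ) s m (i + 1)) (betaSeq_mem s (n + 1) 1)
        (l := l) (l' := l + (i + 1 + m)) (by omega)).eq
      have c2 := (hs.commute (shuffleSeq_mem (k := ℤ) s (m + 1) i) (betaSeq_mem s (n + 1) 1)
        (l := l) (l' := l + (i + 1 + m)) (by omega)).eq
      have b1 := betaSeq_add_left s (m + 1) (n + 1) 1 (l + i)
      have n1 := betaSeq_mul_right hs (b := 1)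
        (strandAlg_mono (by omega : n + 1 + (m + 1) ≤ m + 1 + (n + 1))
          (shuffleSeq_mem (k := ℤ) s (n + 1) (m + 1))) (l + i)
      have d1 := shuffleSeq_succ_succ s n (i + 1 + m) l
      have d2 := shuffleSeq_succ_succ s m i l
      have d3 := shuffleSeq_succ_succ s (m + 1 + n) i l
      have d4 := shuffleSeq_succ_succ s n m (l + (i + 1))
      rw [show i + (m + 1) = i + 1 + m by omega] at ih3
      rw [show l + (i + 1) + m = l + (i + 1 + m) by omega] at d4
      rw [show l + i + (m + 1) = l + (i + 1 + m) by omega] at b1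
      rw [← add_assoc (i + 1), d1, add_mul]
      rw [show i + 1 + m + 1 = i + 1 + (m + 1) by omega, ih1, d2, mul_add, mul_assoc, ← c1,
        ← mul_assoc, ih2, mul_assoc (shuffleSeq s (n + 1) _ l), ← mul_assoc (betaSeq s (n + 1) 1 _),
        ← c2, mul_assoc _ (betaSeq s (n + 1) 1 _), ← b1, ← mul_assoc (shuffleSeq s (n + 1) _ l),
        ih3, mul_assoc _ _ (betaSeq s (m + 1 + (n + 1)) 1 _), ← n1, ← add_assoc (m + 1), d3, add_mul]
      nth_rewrite 1 [d4]
      rw [mul_add, show m + (n + 1) = m + 1 + n by omega]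
      simp only [mul_assoc, add_assoc]

end Seq

/-! ### The Yetter--Drinfeld identity -/

section YetterDrinfeld

variable {k : Type*} [CommRing k] {A : Type*} [Ring A] [Algebra k A]

/-- The summand 1 of the factor is expanded with the last-strand recursion and the summand $-t\beta$
with the first-strand one. Then $\beta_{m+f-1,1}$ slides past $Ш_{m,f-1}^{\uparrow1}$, so that the
two terms with $Ш_{m,f-1}$ combine. -/
theorem pochFactor_mul_shuffleSeq {s : ℕ → A} (hs : IsBraidSeq s) (t : k) {m f : ℕ}
    (h : 0 < m + f) (l : ℕ) :
    (1 - t • betaSeq s (m + f - 1) 1 l) * shuffleSeq s m f l =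
      shufflePredLeft s m f l +
        shufflePredRight s m f l *
          (betaSeq s m 1 (l + (f - 1)) * (1 - t • betaSeq s (f - 1) 1 l)) -
      t • (betaSeq s (m + f - 1) 1 l * (shufflePredLeft s m f (l + 1) * betaSeq s 1 f l)) := by
  have hn : shufflePredRight s m f l * (betaSeq s m 1 (l + (f - 1)) * betaSeq s (f - 1) 1 l) =
      betaSeq s (m + f - 1) 1 l * shufflePredRight s m f (l + 1) := by
    cases f with
    | zero => simp
    | succ f =>
      simp only [Nat.add_sub_cancel, shufflePredRight_succ, ← add_assoc]
      rw [← betaSeq_add_left, add_comm f m]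
      exact (betaSeq_mul_right hs (shuffleSeq_mem (k := ℤ) s m f) l).symm
  rw [sub_mul, one_mul, smul_mul_assoc]
  nth_rewrite 2 [shuffleSeq_eq' hs h]
  rw [shuffleSeq_eq s h, mul_sub, mul_sub, mul_add, ← hn, mul_one, mul_smul_comm, mul_smul_comm]
  simp only [smul_add]
  abel

/-- The left-hand side of the Yetter--Drinfeld identity. -/
def ydLeft (s : ℕ → A) (t : k) (f h b c l : ℕ) : A :=
  ∑ p ∈ Finset.HasAntidiagonal.antidiagonal c, if p.1 ≤ f ∧ p.2 ≤ h then
    shuffleSeq s (h - p.2) (f - p.1) l * shuffleSeq s p.2 p.1 (l + b) *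
      (betaSeq s (h - p.2) p.1 (l + (f - p.1)) * pochSeq s t (f - p.1) p.1 l) else 0

/-- The right-hand side of the Yetter--Drinfeld identity. -/
def ydRight (s : ℕ → A) (t : k) (f h b c l : ℕ) : A :=
  ∑ g ∈ Finset.range (c + 1), if g ≤ h then
    t ^ g • (shuffleSeq s (c - g) g (l + b) * (betaSeq s b g l * (pochSeq s t b (c - g) (l + g) *
      (shuffleSeq s (h - g) f (l + g) * betaSeq s g f l)))) else 0

/-- The value `F (n - 1)`, replaced by zero for `n = 0`. -/
def predZero (F : ℕ → A) : ℕ → A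
  | 0 => 0
  | n + 1 => F n

/-- The last column of $\beta_{u,n+1}$ and the last factor of the Pochhammer symbol are peeled off
to the right, producing the multiplier of the recursion in `ydLeft_succ`. -/
theorem betaSeq_mul_betaSeq_mul_pochSeq {s : ℕ → A} (hs : IsBraidSeq s) (t : k)
    (m u j n l : ℕ) :
    betaSeq s m 1 (l + j + u + n) * (betaSeq s u (n + 1) (l + j) * pochSeq s t j (n + 1) l) =
      betaSeq s u n (l + j) * pochSeq s t j n l *
        (betaSeq s (u + m) 1 (l + j + n) * (1 - t • betaSeq s (j + n) 1 l)) := by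
  have c1 := (hs.commute (betaSeq_mem (k := ℤ) s u n) (betaSeq_mem s m 1)
    (l := l + j) (l' := l + j + u + n) (by omega)).eq
  have c2 := (hs.commute (pochSeq_mem s t j n) (betaSeq_mem s (u + m) 1)
    (l := l) (l' := l + j + n) (by omega)).eq
  have b := betaSeq_add_left s u m 1 (l + j + n)
  rw [show l + j + n + u = l + j + u + n by omega] at b
  rw [betaSeq_add_right hs, pochSeq]
  simp only [mul_assoc]
  rw [mul_eq_mul_reassoc c2, b, mul_eq_mul_reassoc c1.symm]
  simp only [mul_assoc]

/-- Expanding $Ш_{p_2,p_1}^{\uparrow b}$ by its last strand lowers either $p_2$ or $p_1$; after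
reindexing this lowers `h` or `f` respectively. -/
theorem ydLeft_succ {s : ℕ → A} (hs : IsBraidSeq s) (t : k) {f h b c : ℕ}
    (hbc : f + h = b + (c + 1)) (l : ℕ) :
    ydLeft s t f h b (c + 1) l = predZero (fun h => ydLeft s t f h b c l) h +
      predZero (fun f => ydLeft s t f h b c l) f *
        (betaSeq s h 1 (l + (f - 1)) * (1 - t • betaSeq s (f - 1) 1 l)) := by
  have split : ydLeft s t f h b (c + 1) l =
      (∑ p ∈ Finset.HasAntidiagonal.antidiagonal (c + 1), if p.1 ≤ f ∧ p.2 ≤ h then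
        shuffleSeq s (h - p.2) (f - p.1) l * shufflePredLeft s p.2 p.1 (l + b) *
          (betaSeq s (h - p.2) p.1 (l + (f - p.1)) * pochSeq s t (f - p.1) p.1 l) else 0) +
      (∑ p ∈ Finset.HasAntidiagonal.antidiagonal (c + 1), if p.1 ≤ f ∧ p.2 ≤ h then
        shuffleSeq s (h - p.2) (f - p.1) l * shufflePredRight s p.2 p.1 (l + b) *
          (betaSeq s p.2 1 (l + b + (p.1 - 1)) *
          (betaSeq s (h - p.2) p.1 (l + (f - p.1)) * pochSeq s t (f - p.1) p.1 l)) else 0) := by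
    rw [ydLeft, ← Finset.sum_add_distrib]
    refine Finset.sum_congr rfl fun p hp => ?_
    rw [Finset.HasAntidiagonal.mem_antidiagonal] at hp
    split_ifs
    · rw [shuffleSeq_eq s (m := p.2) (n := p.1) (by omega)]
      noncomm_ring
    · simp
  rw [split]
  congr 1
  · rw [Finset.Nat.sum_antidiagonal_succ']
    cases h with
    | zero => simp [predZero]
    | succ h => simp [predZero, ydLeft]
  · rw [Finset.Nat.sum_antidiagonal_succ]
    cases f with
    | zero => simp [predZero]
    | succ f =>
      simp only [predZero, ydLeft, shufflePredRight_zero, mul_zero, zero_mul, ite_self, zero_add,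
        shufflePredRight_succ, Nat.add_sub_cancel, Nat.add_sub_add_right, add_le_add_iff_right,
        Finset.sum_mul]
      refine Finset.sum_congr rfl fun p hp => ?_
      rw [Finset.HasAntidiagonal.mem_antidiagonal] at hp
      split_ifs with hc
      · have := betaSeq_mul_betaSeq_mul_pochSeq hs t p.2 (h - p.2) (f - p.1) p.1 l
        rw [show l + (f - p.1) + (h - p.2) + p.1 = l + b + p.1 by omega,
          show h - p.2 + p.2 = h by omega, show l + (f - p.1) + p.1 = l + f by omega,
          show f - p.1 + p.1 = f by omega] at this
        rw [this]
        simp only [mul_assoc]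
      · simp

/-- The term with $g+1$ on the left cancels the negative term that `pochFactor_mul_shuffleSeq`
produces from the last Pochhammer factor of the term with $g$. -/
theorem ydRight_term {s : ℕ → A} (hs : IsBraidSeq s) (t : k) {f m b d : ℕ}
    (hbd : f + m = b + d + 1) (g l : ℕ) :
    betaSeq s b g l * (pochSeq s t b (d + 1) (l + g) *
        (shuffleSeq s m f (l + g) * betaSeq s g f l)) +
      t • (betaSeq s d 1 (l + b + g) * (betaSeq s b (g + 1) l * (pochSeq s t b d (l + (g + 1)) *
        (shufflePredLeft s m f (l + (g + 1)) * betaSeq s (g + 1) f l)))) =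
    betaSeq s b g l * (pochSeq s t b d (l + g) *
        (shufflePredLeft s m f (l + g) * betaSeq s g f l)) +
      betaSeq s b g l * (pochSeq s t b d (l + g) *
        (shufflePredRight s m f (l + g) * betaSeq s g (f - 1) l)) *
          (betaSeq s (g + m) 1 (l + (f - 1)) * (1 - t • betaSeq s (f - 1) 1 l)) := by
  have h3 : betaSeq s b g l * (pochSeq s t b d (l + g) * (betaSeq s (b + d) 1 (l + g) *
      (shufflePredLeft s m f (l + g + 1) * (betaSeq s 1 f (l + g) * betaSeq s g f l)))) =
      betaSeq s d 1 (l + b + g) * (betaSeq s b (g + 1) l * (pochSeq s t b d (l + (g + 1)) *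
        (shufflePredLeft s m f (l + (g + 1)) * betaSeq s (g + 1) f l))) := by
    have n1 := betaSeq_mul_right hs (b := 1) (pochSeq_mem s t b d) (l + g)
    have c1 := (hs.commute (betaSeq_mem (k := ℤ) s b g) (betaSeq_mem s d 1)
      (l := l) (l' := l + b + g) (by omega)).eq
    have b1 := betaSeq_add_left s b d 1 (l + g)
    rw [show l + g + b = l + b + g by omega] at b1
    rw [← betaSeq_add_left, mul_eq_mul_reassoc n1.symm, b1, betaSeq_add_right hs b g 1]
    simp only [mul_assoc, add_assoc] at c1 ⊢
    rw [mul_eq_mul_reassoc c1]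
  have h2 : shufflePredRight s m f (l + g) * (betaSeq s m 1 (l + g + (f - 1)) *
        ((1 - t • betaSeq s (f - 1) 1 (l + g)) * betaSeq s g f l)) =
      shufflePredRight s m f (l + g) * (betaSeq s g (f - 1) l *
        (betaSeq s (g + m) 1 (l + (f - 1)) * (1 - t • betaSeq s (f - 1) 1 l))) := by
    cases f with
    | zero => simp
    | succ f =>
      simp only [Nat.add_sub_cancel]
      have n1 := betaSeq_mul_left hs (a := g) (pochFactor_mem s t f) l
      have c1 := (hs.commute (betaSeq_mem (k := ℤ) s g f) (betaSeq_mem s m 1)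
        (l := l) (l' := l + g + f) (by omega)).eq
      have b1 := betaSeq_add_left s g m 1 (l + f)
      rw [show l + f + g = l + g + f by omega] at b1
      rw [← n1, betaSeq_add_right hs, b1]
      simp only [mul_assoc]
      rw [mul_eq_mul_reassoc c1]
  have h1 := pochFactor_mul_shuffleSeq hs t (m := m) (f := f) (by omega) (l + g)
  rw [show m + f - 1 = b + d by omega] at h1
  rw [← h3, pochSeq, mul_assoc (pochSeq s t b d _), ← mul_assoc (1 - _), h1]
  replace h2 := congrArg (fun x => betaSeq s b g l * (pochSeq s t b d (l + g) * x)) h2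
  simp only [mul_add, mul_sub, sub_mul, add_mul, mul_assoc, smul_mul_assoc, mul_smul_comm] at h2 ⊢
  rw [h2, sub_add_cancel]

/-- Expanding $Ш_{c+1-g,g}^{\uparrow b}$ gives two families. Shifting $g$ in the second gives both
the common prefix $Ш_{c-g,g}^{\uparrow b}$, and `ydRight_term` treats each pair. -/
theorem ydRight_succ {s : ℕ → A} (hs : IsBraidSeq s) (t : k) {f h b c : ℕ}
    (hbc : f + h = b + (c + 1)) (l : ℕ) :
    ydRight s t f h b (c + 1) l = predZero (fun h => ydRight s t f h b c l) h +
      predZero (fun f => ydRight s t f h b c l) f *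
        (betaSeq s h 1 (l + (f - 1)) * (1 - t • betaSeq s (f - 1) 1 l)) := by
  have split : ydRight s t f h b (c + 1) l =
      ∑ g ∈ Finset.range (c + 1),
        ((if g ≤ h then t ^ g • (shuffleSeq s (c - g) g (l + b) * (betaSeq s b g l *
          (pochSeq s t b (c - g + 1) (l + g) * (shuffleSeq s (h - g) f (l + g) *
            betaSeq s g f l)))) else 0) +
        (if g + 1 ≤ h then t ^ (g + 1) • (shuffleSeq s (c - g) g (l + b) *
          (betaSeq s (c - g) 1 (l + b + g) * (betaSeq s b (g + 1) l *
          (pochSeq s t b (c - g) (l + (g + 1)) * (shuffleSeq s (h - (g + 1)) f (l + (g + 1)) *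
            betaSeq s (g + 1) f l))))) else 0)) := by
    have e : ydRight s t f h b (c + 1) l =
      (∑ g ∈ Finset.range (c + 1 + 1), if g ≤ h then
        t ^ g • (shufflePredLeft s (c + 1 - g) g (l + b) * (betaSeq s b g l *
          (pochSeq s t b (c + 1 - g) (l + g) *
            (shuffleSeq s (h - g) f (l + g) * betaSeq s g f l)))) else 0) +
      (∑ g ∈ Finset.range (c + 1 + 1), if g ≤ h then
        t ^ g • (shufflePredRight s (c + 1 - g) g (l + b) *
          (betaSeq s (c + 1 - g) 1 (l + b + (g - 1)) * (betaSeq s b g l *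
          (pochSeq s t b (c + 1 - g) (l + g) *
            (shuffleSeq s (h - g) f (l + g) * betaSeq s g f l))))) else 0) := by
      rw [ydRight, ← Finset.sum_add_distrib]
      refine Finset.sum_congr rfl fun g hg => ?_
      rw [Finset.mem_range] at hg
      split_ifs
      · rw [shuffleSeq_eq s (m := c + 1 - g) (n := g) (by omega), add_mul, smul_add, mul_assoc]
      · simp
    rw [e, Finset.sum_range_succ, Finset.sum_range_succ' _ (c + 1), Finset.sum_add_distrib]
    simp only [Nat.sub_self, shufflePredLeft_zero, shufflePredRight_zero, zero_mul, smul_zero,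
      ite_self, add_zero]
    congr 1
    · refine Finset.sum_congr rfl fun g hg => ?_
      rw [Finset.mem_range] at hg
      rw [show c + 1 - g = c - g + 1 by omega, shufflePredLeft_succ]
    · refine Finset.sum_congr rfl fun g hg => ?_
      rw [Finset.mem_range] at hg
      rw [show c + 1 - (g + 1) = c - g by omega, shufflePredRight_succ, Nat.add_sub_cancel]
  have hterm : ∀ g ∈ Finset.range (c + 1),
        ((if g ≤ h then t ^ g • (shuffleSeq s (c - g) g (l + b) * (betaSeq s b g l *
          (pochSeq s t b (c - g + 1) (l + g) * (shuffleSeq s (h - g) f (l + g) *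
            betaSeq s g f l)))) else 0) +
        (if g + 1 ≤ h then t ^ (g + 1) • (shuffleSeq s (c - g) g (l + b) *
          (betaSeq s (c - g) 1 (l + b + g) * (betaSeq s b (g + 1) l *
          (pochSeq s t b (c - g) (l + (g + 1)) * (shuffleSeq s (h - (g + 1)) f (l + (g + 1)) *
            betaSeq s (g + 1) f l))))) else 0)) =
        (if g ≤ h then t ^ g • (shuffleSeq s (c - g) g (l + b) * (betaSeq s b g l *
          (pochSeq s t b (c - g) (l + g) * (shufflePredLeft s (h - g) f (l + g) *
            betaSeq s g f l)))) else 0) +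
        (if g ≤ h then t ^ g • (shuffleSeq s (c - g) g (l + b) * (betaSeq s b g l *
          (pochSeq s t b (c - g) (l + g) * (shufflePredRight s (h - g) f (l + g) *
            betaSeq s g (f - 1) l)))) else 0) *
            (betaSeq s h 1 (l + (f - 1)) * (1 - t • betaSeq s (f - 1) 1 l)) := by
    intro g hg
    rw [Finset.mem_range] at hg
    by_cases hgh : g ≤ h
    · have key := ydRight_term hs t (f := f) (m := h - g) (b := b) (d := c - g) (by omega) g l
      rw [show g + (h - g) = h by omega] at key
      have e2 : (if g + 1 ≤ h then t ^ (g + 1) • (shuffleSeq s (c - g) g (l + b) *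
          (betaSeq s (c - g) 1 (l + b + g) * (betaSeq s b (g + 1) l *
          (pochSeq s t b (c - g) (l + (g + 1)) * (shuffleSeq s (h - (g + 1)) f (l + (g + 1)) *
            betaSeq s (g + 1) f l))))) else 0) =
          t ^ (g + 1) • (shuffleSeq s (c - g) g (l + b) *
          (betaSeq s (c - g) 1 (l + b + g) * (betaSeq s b (g + 1) l *
          (pochSeq s t b (c - g) (l + (g + 1)) * (shufflePredLeft s (h - g) f (l + (g + 1)) *
            betaSeq s (g + 1) f l))))) := by
        split_ifs with hh
        · rw [show h - g = h - (g + 1) + 1 by omega, shufflePredLeft_succ]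
        · simp [show h - g = 0 by omega]
      rw [e2, if_pos hgh, if_pos hgh, if_pos hgh, smul_mul_assoc, mul_assoc (shuffleSeq s _ _ _),
        ← smul_add, ← mul_add, ← key, mul_add, smul_add, mul_smul_comm, smul_smul, pow_succ]
    · simp [hgh, show ¬ g + 1 ≤ h by omega]
  rw [split, Finset.sum_congr rfl hterm, Finset.sum_add_distrib, ← Finset.sum_mul]
  congr 1
  · cases h with
    | zero =>
      simp only [predZero]
      refine Finset.sum_eq_zero fun g _ => ?_
      split_ifs with hh
      · simp
      · rfl
    | succ h =>
      simp only [predZero, ydRight]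
      refine Finset.sum_congr rfl fun g _ => ?_
      by_cases hh : g ≤ h
      · rw [if_pos hh, if_pos (by omega), show h + 1 - g = h - g + 1 by omega,
          shufflePredLeft_succ]
      · rw [if_neg hh]
        split_ifs
        · simp [show h + 1 - g = 0 by omega]
        · rfl
  · congr 1
    cases f with
    | zero => simp [predZero]
    | succ f => simp [predZero, ydRight]

/-- The Yetter--Drinfeld identity for the shuffle and Pochhammer elements. -/
theorem ydLeft_eq_ydRight {s : ℕ → A} (hs : IsBraidSeq s) (t : k) {f h b c : ℕ}
    (hbc : f + h = b + c) (l : ℕ) : ydLeft s t f h b c l = ydRight s t f h b c l := by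
  induction c generalizing f h with
  | zero => simp [ydLeft, ydRight]
  | succ c ih =>
    rw [ydLeft_succ hs t hbc, ydRight_succ hs t hbc]
    congr 1
    · cases h with
      | zero => rfl
      | succ h => exact ih (by omega)
    · congr 1
      cases f with
      | zero => rfl
      | succ f => exact ih (by omega)

end YetterDrinfeld

/-! ### The block-triangular Yang--Baxter system for a braid sequence -/

section System

variable {k : Type*} [CommRing k] {A : Type*} [Ring A] [Algebra k A]

/-- Here $i=e+g$. The two symbols starting at `a` and `a + g` merge into one, the pieces of
$\beta_{a,e+f}$ merge, and shuffle associativity brings the index-free $Ш_{g+p,e}$ to the front. -/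
theorem left_term_eq {s : ℕ → A} (hs : IsBraidSeq s) (t : k) (a b e f g m p l : ℕ) :
    shuffleSeq s p (e + g) (l + a + b) * betaSeq s b (e + g) (l + a) *
        pochSeq s t b p (l + a + (e + g)) *
      (shuffleSeq s g e (l + a) * betaSeq s a e l * pochSeq s t a g (l + e)) *
      (shuffleSeq s m f (l + e + (a + g)) * betaSeq s (a + g) f (l + e) *
        pochSeq s t (a + g) m (l + e + f)) =
    shuffleSeq s (g + p) e (l + a + b) * betaSeq s b e (l + a) *
      (shuffleSeq s p g (l + a + e + b) * (betaSeq s b g (l + a + e) *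
        (pochSeq s t b p (l + a + e + g) * (shuffleSeq s m f (l + a + e + g) *
          betaSeq s g f (l + a + e))))) *
      (betaSeq s a (e + f) l * pochSeq s t a (g + m) (l + e + f)) := by
  have h1 := (hs.commute (pochSeq_mem s t a g) (shuffleSeq_mem s m f)
    (l := l + e) (l' := l + e + (a + g)) (by omega)).eq
  have h2 := betaSeq_mul_right hs (b := f) (pochSeq_mem s t a g) (l + e)
  have h3 := pochSeq_add s t a g m (l + e + f)
  have h4 := (hs.commute (betaSeq_mem (k := ℤ) s a e) (shuffleSeq_mem s m f)
    (l := l) (l' := l + e + (a + g)) (by omega)).eq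
  have h4' := betaSeq_add_left s a g f (l + e)
  have h4'' := (hs.commute (betaSeq_mem (k := ℤ) s a e) (betaSeq_mem s g f)
    (l := l) (l' := l + e + a) (by omega)).eq
  have h4''' := betaSeq_add_right hs a e f l
  have h5 := (hs.commute (shuffleSeq_mem s g e) (pochSeq_mem s t b p)
    (l := l + a) (l' := l + a + (e + g)) (by omega)).eq
  have h6 := betaSeq_mul_left hs (a := b) (strandAlg_mono (by omega : g + e ≤ e + g)
    (shuffleSeq_mem (k := ℤ) s g e)) (l + a)
  have h7 := shuffleSeq_assoc hs p g e (l + a + b)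
  have h8 := betaSeq_add_right hs b e g (l + a)
  have h8' := (hs.commute (betaSeq_mem (k := ℤ) s b e) (shuffleSeq_mem s p g)
    (l := l + a) (l' := l + a + e + b) (by omega)).eq
  -- Shifts and products are put into a normal form, so that the relations above match
  -- syntactically.
  simp only [add_comm, add_left_comm, mul_assoc] at *
  rw [mul_eq_mul_reassoc h1, mul_eq_mul_reassoc h2.symm, ← h3, mul_eq_mul_reassoc h4, h4',
    mul_assoc, mul_eq_mul_reassoc h4'', ← mul_assoc (betaSeq s a e _) (betaSeq s a f _), ← h4''',
    mul_eq_mul_reassoc h5.symm, mul_eq_mul_reassoc h6, mul_eq_mul_reassoc h7, h8, mul_assoc,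
    mul_eq_mul_reassoc h8'.symm]

theorem right_term_eq {s : ℕ → A} (hs : IsBraidSeq s) (t : k) (a e j n u v l : ℕ) :
    shuffleSeq s u j (l + a) * betaSeq s a j l * pochSeq s t a u (l + j) *
      (shuffleSeq s v (e + n) (l + j + (a + u)) * betaSeq s (a + u) (e + n) (l + j) *
        pochSeq s t (a + u) v (l + j + (e + n))) *
      (shuffleSeq s n e (l + j) * betaSeq s j e l * pochSeq s t j n (l + e)) =
    shuffleSeq s (n + v) e (l + a + (j + u)) * betaSeq s (j + u) e (l + a) *
      (shuffleSeq s u j (l + a + e) * shuffleSeq s v n (l + a + e + (j + u)) *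
        (betaSeq s u n (l + a + e + j) * pochSeq s t j n (l + a + e))) *
      (betaSeq s a (e + (j + n)) l * pochSeq s t a (u + v) (l + e + (j + n))) := by
  -- The whole last factor lives on $j+e+n$ strands, so it moves as one element past $P_{a,u+v}$ and
  -- then through $\beta_{a,j+e+n}$.
  have hW : (fun l => shuffleSeq s n e (l + j) * betaSeq s j e l * pochSeq s t j n (l + e)) ∈
      strandAlg k s (j + (e + n)) :=
    mul_mem (mul_mem (strandAlg_shift j (by omega) (shuffleSeq_mem s n e))
      (strandAlg_mono (by omega) (betaSeq_mem s j e)))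
      (strandAlg_shift e (by omega) (pochSeq_mem s t j n))
  have hW1 := (hs.commute hW (pochSeq_mem s t a (u + v)) (l := l) (l' := l + (j + (e + n)))
    (by omega)).eq
  have hW2 := congrArg (fun x => x * pochSeq s t a (u + v) (l + (j + (e + n))))
    (betaSeq_mul_left hs (a := a) hW l)
  have h1 := (hs.commute (pochSeq_mem s t a u) (shuffleSeq_mem s v (e + n))
    (l := l + j) (l' := l + j + (a + u)) (by omega)).eq
  have h2 := betaSeq_mul_right hs (b := e + n) (pochSeq_mem s t a u) (l + j)
  have h3 := pochSeq_add s t a u v (l + j + (e + n))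
  have h4 := (hs.commute (betaSeq_mem (k := ℤ) s a j) (shuffleSeq_mem s v (e + n))
    (l := l) (l' := l + j + (a + u)) (by omega)).eq
  have h4' := betaSeq_add_left s a u (e + n) (l + j)
  have h4'' := (hs.commute (betaSeq_mem (k := ℤ) s a j) (betaSeq_mem s u (e + n))
    (l := l) (l' := l + j + a) (by omega)).eq
  have h4''' := betaSeq_add_right hs a j (e + n) l
  have h5 := betaSeq_mul_left hs (a := u) (strandAlg_mono (by omega : n + e ≤ e + n)
    (shuffleSeq_mem (k := ℤ) s n e)) (l + j + a)
  have h6 := shuffleSeq_assoc hs v n e (l + j + (a + u))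
  have h7 := betaSeq_add_right hs u e n (l + j + a)
  have h7' := (hs.commute (betaSeq_mem (k := ℤ) s j e) (betaSeq_mem s u n)
    (l := l + a) (l' := l + j + a + e) (by omega)).eq
  have h7'' := betaSeq_add_left s j u e (l + a)
  have h8 := (hs.commute (betaSeq_mem (k := ℤ) s (j + u) e) (shuffleSeq_mem s v n)
    (l := l + a) (l' := l + j + (a + u) + e) (by omega)).eq
  have h9 := (hs.commute (shuffleSeq_mem (k := ℤ) s u j) (shuffleSeq_mem s (n + v) e)
    (l := l + a) (l' := l + j + (a + u)) (by omega)).eq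
  have h10 := betaSeq_mul_right hs (b := e) (strandAlg_mono (by omega : u + j ≤ j + u)
    (shuffleSeq_mem (k := ℤ) s u j)) (l + a)
  simp only [add_comm, add_left_comm, mul_assoc] at *
  rw [mul_eq_mul_reassoc h1, mul_eq_mul_reassoc h2.symm, mul_eq_reassoc h3.symm, ← hW1,
    mul_eq_mul_reassoc h4, h4']
  simp only [mul_assoc]
  rw [mul_eq_mul_reassoc h4'', mul_eq_reassoc h4'''.symm, hW2,
    mul_eq_mul_reassoc h5, mul_eq_mul_reassoc h6, h7]
  simp only [mul_assoc]
  rw [mul_eq_mul_reassoc h7'.symm, mul_eq_reassoc h7''.symm, mul_eq_mul_reassoc h8.symm,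
    mul_eq_mul_reassoc h9, mul_eq_mul_reassoc h10.symm]

/-- The elements `A^{a,b}_c` with shift `l`. -/
def solutionSeq (s : ℕ → A) (q : kˣ) (a b c l : ℕ) : A :=
  if c ≤ b then
    ((q ^ (1 - (a : ℤ) - (c : ℤ)) : kˣ) : k) •
      (shuffleSeq s (b - c) c (l + a) * betaSeq s a c l *
        pochSeq s ((q ^ (-2 : ℤ) : kˣ) : k) a (b - c) (l + c))
  else 0

theorem solutionSeq_of_eq (s : ℕ → A) (q : kˣ) {a b c n : ℕ} (h : b = n + c) (l : ℕ) :
    solutionSeq s q a b c l = ((q ^ (1 - (a : ℤ) - (c : ℤ)) : kˣ) : k) •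
      (shuffleSeq s n c (l + a) * betaSeq s a c l *
        pochSeq s ((q ^ (-2 : ℤ) : kˣ) : k) a n (l + c)) := by
  subst h
  simp [solutionSeq]

theorem solutionSeq_left_eq {s : ℕ → A} (hs : IsBraidSeq s) (q : kˣ) {a b e f h C l : ℕ}
    (hh : f + h = b + C) :
    ∑ i ∈ Finset.Icc e (C + e) with i + f ≤ b + (C + e),
      solutionSeq s q b (C + e) i (l + a) * solutionSeq s q a i e l *
        solutionSeq s q (a + i - e) (b + (C + e) - i) f (l + e) =
    ((q ^ (3 - 2 * (a : ℤ) - b - f - 2 * e) : kˣ) : k) •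
      (shuffleSeq s C e (l + a + b) * betaSeq s b e (l + a) *
      ydRight s ((q ^ (-2 : ℤ) : kˣ) : k) f h b C (l + a + e) *
      (betaSeq s a (e + f) l * pochSeq s ((q ^ (-2 : ℤ) : kˣ) : k) a h (l + e + f))) := by
  rw [Finset.sum_filter, ← Finset.Ico_add_one_right_eq_Icc, Finset.sum_Ico_eq_sum_range, ydRight,
    Finset.mul_sum, Finset.sum_mul, Finset.smul_sum, show C + e + 1 - e = C + 1 by omega]
  refine Finset.sum_congr rfl fun g hg => ?_
  rw [Finset.mem_range] at hg
  by_cases hgh : g ≤ h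
  · rw [if_pos hgh, if_pos (by omega), solutionSeq_of_eq s q (n := C - g) (by omega),
      solutionSeq_of_eq s q (n := g) (by omega),
      solutionSeq_of_eq s q (n := h - g) (by omega), show a + (e + g) - e = a + g by omega,
      smul_mul_smul_comm, smul_mul_smul_comm, left_term_eq hs, show g + (C - g) = C by omega,
      show g + (h - g) = h by omega, mul_smul_comm, smul_mul_assoc, smul_smul]
    congr 1
    -- The three exponents of $q$ add up to $3-2a-b-f-2e-2g$, and the part $-2g$ is the factor $t^g$
    -- in `ydRight`.
    rw [← Units.val_pow_eq_pow_val]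
    simp only [← Units.val_mul]
    congr 1
    rw [← zpow_natCast, ← zpow_mul]
    simp only [← zpow_add]
    congr 1
    push_cast
    ring
  · rw [if_neg hgh, if_neg (by omega)]
    simp

theorem solutionSeq_right_eq {s : ℕ → A} (hs : IsBraidSeq s) (q : kˣ) {a b e f h C l : ℕ}
    (hh : f + h = b + C) :
    ∑ j ∈ Finset.Icc 0 (min f b) with f + e ≤ j + (C + e),
      solutionSeq s q a b j l * solutionSeq s q (a + b - j) (C + e) (f + e - j) (l + j) *
        solutionSeq s q j (f + e - j) e l =
    ((q ^ (3 - 2 * (a : ℤ) - b - f - 2 * e) : kˣ) : k) •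
      (shuffleSeq s C e (l + a + b) * betaSeq s b e (l + a) *
      ydLeft s ((q ^ (-2 : ℤ) : kˣ) : k) f h b C (l + a + e) *
      (betaSeq s a (e + f) l * pochSeq s ((q ^ (-2 : ℤ) : kˣ) : k) a h (l + e + f))) := by
  rw [ydLeft, Finset.mul_sum, Finset.sum_mul, Finset.smul_sum]
  have hr : ∀ p : ℕ × ℕ, ∀ x y z : A, ∀ r : k, r • (x * (if p.1 ≤ f ∧ p.2 ≤ h then y else 0) * z) =
      if p.1 ≤ f ∧ p.2 ≤ h then r • (x * y * z) else 0 := by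
    intro p x y z r
    split_ifs <;> simp
  simp only [hr]
  rw [← Finset.sum_filter]
  -- The index $j$ corresponds to $p_1=f-j$, $p_2=C-p_1$; the bounds on $j$ become $p_1\le f$ and
  -- $p_2\le h$. The exponents of $q$ now add up independently of $j$.
  refine Finset.sum_nbij' (fun j => (f - j, C - (f - j))) (fun p => f - p.1) ?_ ?_ ?_ ?_ ?_
  · intro j hj
    simp only [Finset.mem_filter, Finset.mem_Icc, le_min_iff,
      Finset.HasAntidiagonal.mem_antidiagonal] at hj ⊢
    omega
  · intro p hp
    simp only [Finset.mem_filter, Finset.mem_Icc, le_min_iff,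
      Finset.HasAntidiagonal.mem_antidiagonal] at hp ⊢
    omega
  · intro j hj
    simp only [Finset.mem_filter, Finset.mem_Icc, le_min_iff] at hj
    omega
  · intro p hp
    simp only [Finset.mem_filter, Finset.HasAntidiagonal.mem_antidiagonal] at hp
    ext <;> simp only <;> omega
  · intro j hj
    simp only [Finset.mem_filter, Finset.mem_Icc, le_min_iff] at hj
    obtain ⟨n, rfl⟩ : ∃ n, f = j + n := ⟨f - j, by omega⟩
    obtain ⟨u, rfl⟩ : ∃ u, b = j + u := ⟨b - j, by omega⟩
    obtain ⟨v, rfl⟩ : ∃ v, C = n + v := ⟨C - n, by omega⟩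
    obtain rfl : h = u + v := by omega
    simp only [show j + n - j = n by omega, show n + v - n = v by omega,
      show j + n - n = j by omega, show u + v - v = u by omega]
    rw [solutionSeq_of_eq s q (n := u) (by omega), solutionSeq_of_eq s q (n := v) (by omega),
      solutionSeq_of_eq s q (n := n) (by omega), show a + (j + u) - j = a + u by omega,
      show j + n + e - j = e + n by omega, smul_mul_smul_comm, smul_mul_smul_comm,
      right_term_eq hs]
    congr 1
    simp only [← Units.val_mul, ← zpow_add]
    congr 2
    push_cast
    ring

theorem solutionSeq_system {s : ℕ → A} (hs : IsBraidSeq s) (q : kˣ) (a b c e f l : ℕ) :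
    ∑ i ∈ Finset.Icc e c with i + f ≤ b + c,
      solutionSeq s q b c i (l + a) * solutionSeq s q a i e l *
        solutionSeq s q (a + i - e) (b + c - i) f (l + e) =
    ∑ j ∈ Finset.Icc 0 (min f b) with f + e ≤ j + c,
      solutionSeq s q a b j l * solutionSeq s q (a + b - j) c (f + e - j) (l + j) *
        solutionSeq s q j (f + e - j) e l := by
  by_cases h : e ≤ c ∧ e + f ≤ b + c
  · obtain ⟨C, rfl⟩ : ∃ C, c = C + e := ⟨c - e, by omega⟩
    have hh : f + (b + C - f) = b + C := by omega
    rw [solutionSeq_left_eq hs q hh, solutionSeq_right_eq hs q hh, ydLeft_eq_ydRight hs _ hh]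
  -- Outside this range both sums are empty.
  · rw [Finset.filter_false_of_mem, Finset.filter_false_of_mem]
    · simp
    · intro j hj
      simp only [Finset.mem_Icc, le_min_iff] at hj
      omega
    · intro i hi
      simp only [Finset.mem_Icc] at hi
      omega

end System

/-! ### The universal solution -/

section Universal

variable {k : Type u} [Field k]

/-- The Artin generators of `B_n` in the group algebra, continued by zero. -/
def artinSeq (k : Type u) [Field k] (n i : ℕ) : MonoidAlgebra k (BraidGroup n) :=
  if i < n - 1 then MonoidAlgebra.of k _ (sigma n i) else 0

/-- Continuation by zero is harmless: an out-of-range generator occurs on both sides of a relation,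
which becomes $0=0$. Continuation by 1 would break the braid relation at the edge. -/
theorem artinSeq_isBraidSeq (k : Type u) [Field k] (n : ℕ) : IsBraidSeq (artinSeq k n) where
  braid i := by
    by_cases h : i + 1 < n - 1
    · simp only [artinSeq, if_pos h, if_pos (show i < n - 1 by omega), ← map_mul, sigma_braid n i h]
    · simp [artinSeq, if_neg h]
  comm i j hij := by
    by_cases h : j < n - 1
    · simp only [artinSeq, if_pos h, if_pos (show i < n - 1 by omega), ← map_mul,
        sigma_comm n i j hij h]
    · simp [artinSeq, if_neg h]

theorem shiftGroup_sigma {l m n i : ℕ} (h : l + m ≤ n) (hi : i < m - 1) :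
    shiftGroup l m n (sigma m i) = sigma n (i + l) := by
  rw [shiftGroup, dif_pos h, liftBraid_sigma _ _ _ _ _ hi]

theorem braidGroup_hom_ext {n : ℕ} {G : Type*} [Group G] {φ ψ : BraidGroup n →* G}
    (h : ∀ i, i < n - 1 → φ (sigma n i) = ψ (sigma n i)) : φ = ψ := by
  refine PresentedGroup.ext fun x => ?_
  have := h x x.2
  simpa only [sigma, dif_pos x.2] using this

theorem shiftGroup_comp {l l' m n p : ℕ} (h : l + m ≤ n) (h' : l' + p ≤ m) :
    (shiftGroup l m n).comp (shiftGroup l' p m) = shiftGroup (l + l') p n := by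
  refine braidGroup_hom_ext fun i hi => ?_
  rw [MonoidHom.comp_apply, shiftGroup_sigma h' hi, shiftGroup_sigma h (by omega),
    shiftGroup_sigma (by omega) hi, add_assoc, add_comm l']

theorem up_of (l : ℕ) {m n : ℕ} (g : BraidGroup m) :
    (up l (MonoidAlgebra.of k _ g) : MonoidAlgebra k (BraidGroup n)) =
      MonoidAlgebra.of k _ (shiftGroup l m n g) := by
  simp [up]

theorem groupAlgebra_algHom_ext {G : Type*} [Group G] {B : Type*} [Semiring B] [Algebra k B]
    {φ ψ : MonoidAlgebra k G →ₐ[k] B}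
    (h : ∀ g, φ (MonoidAlgebra.of k G g) = ψ (MonoidAlgebra.of k G g)) : φ = ψ :=
  MonoidAlgebra.algHom_ext' (MonoidHom.ext h) (Subsingleton.elim _ _)

theorem up_up {l l' m n p : ℕ} (h : l + m ≤ n) (h' : l' + p ≤ m)
    (x : MonoidAlgebra k (BraidGroup p)) :
    (up l (up l' x : MonoidAlgebra k (BraidGroup m)) : MonoidAlgebra k (BraidGroup n)) =
      up (l + l') x := by
  suffices H : (up l : MonoidAlgebra k (BraidGroup m) →ₐ[k] MonoidAlgebra k (BraidGroup n)).comp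
      (up l' : MonoidAlgebra k (BraidGroup p) →ₐ[k] _) = up (l + l') from DFunLike.congr_fun H x
  refine groupAlgebra_algHom_ext fun g => ?_
  have := DFunLike.congr_fun (shiftGroup_comp h h') g
  simp only [MonoidHom.comp_apply] at this
  rw [AlgHom.comp_apply, up_of, up_of, up_of, this]

theorem up_beta {l a b n : ℕ} (h : l + (a + b) ≤ n) :
    (up l (beta k a b) : MonoidAlgebra k (BraidGroup n)) = betaSeq (artinSeq k n) a b l := by
  have hgen : ∀ i, i < a + b - 1 → MonoidAlgebra.of k (BraidGroup n) (shiftGroup l (a + b) n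
      (sigma (a + b) i)) = artinSeq k n (i + l) := by
    intro i hi
    rw [shiftGroup_sigma h hi, artinSeq, if_pos (by omega)]
  generalize hψ : (MonoidAlgebra.of k (BraidGroup n)).comp (shiftGroup l (a + b) n) = ψ
  have hψ' : ∀ g, MonoidAlgebra.of k (BraidGroup n) (shiftGroup l (a + b) n g) = ψ g := fun g => by
    rw [← hψ]; rfl
  rw [beta, up_of, hψ', betaBraid]
  simp only [hψ'] at hgen
  clear hψ hψ'
  revert ψ
  generalize hm : a + b = m
  intro ψ hgen
  have hrow : ∀ i b', i + b' + 1 ≤ m →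
      ψ ((List.range b').map fun j => sigma m (i + j)).prod = rowSeq (artinSeq k n) b' (l + i) := by
    intro i b'
    induction b' with
    | zero => simp
    | succ b' ih =>
      intro hb
      rw [List.range_succ, List.map_append, List.prod_append, map_mul, ih (by omega), rowSeq]
      simp only [List.map_cons, List.map_nil, List.prod_singleton]
      rw [hgen _ (by omega), show i + b' + l = b' + (l + i) by omega]
  -- Weakening to an inequality keeps the ambient group $B_m$ fixed during the induction on `a`.
  replace hm : a + b ≤ m := hm.le
  induction a with
  | zero => simp
  | succ a ih =>
    rw [List.range_succ_eq_map, List.map_cons, List.prod_cons, map_mul, betaSeq, List.map_map]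
    congr 1
    · exact hrow _ _ (by omega)
    · rw [← ih (by omega) (by omega)]
      congr 3
      funext i
      simp only [Function.comp_apply, show a + 1 - 1 - i.succ = a - 1 - i by omega]

theorem up_shuffle {l m m' n : ℕ} (h : l + (m + m') ≤ n) :
    (up l (shuffle k m m') : MonoidAlgebra k (BraidGroup n)) =
      shuffleSeq (artinSeq k n) m m' l := by
  suffices H : ∀ N m m', m + m' = N → l + (m + m') ≤ n →
      (up l (shuffle k m m') : MonoidAlgebra k (BraidGroup n)) =
        shuffleSeq (artinSeq k n) m m' l from H _ m m' rfl h
  intro N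
  induction N with
  | zero =>
    intro m m' hm _
    obtain ⟨rfl, rfl⟩ : m = 0 ∧ m' = 0 := by omega
    simp [shuffle]
  | succ N ih =>
    intro m m' hm hn
    match m, m' with
    | 0, m' => simp [shuffle]
    | m + 1, 0 => simp [shuffle]
    | m + 1, m' + 1 =>
      rw [shuffle, shuffleSeq_succ_succ, map_add, map_mul, up_up hn (by omega),
        up_up hn (by omega), up_up hn (by omega), add_zero, ih m (m' + 1) (by omega) (by omega),
        ih (m + 1) m' (by omega) (by omega), up_beta (by omega)]

theorem up_pochhammer {l a m n : ℕ} (t : k) (h : l + (a + m) ≤ n) :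
    (up l (pochhammer a m 1 t) : MonoidAlgebra k (BraidGroup n)) =
      pochSeq (artinSeq k n) t a m l := by
  rw [pochhammer]
  generalize hN : a + m = N at h
  replace hN : a + m ≤ N := hN.le
  induction m with
  | zero => simp
  | succ m ih =>
    rw [List.range_succ, List.map_append, List.prod_append, map_mul, ih (by omega), pochSeq]
    simp only [List.map_cons, List.map_nil, List.prod_singleton]
    rw [map_sub, map_smul, up_up h (by omega), up_beta (by omega), map_one (algebraMap k _),
      map_one, add_zero]

theorem up_solution (q : kˣ) {l a b c n : ℕ} (h : l + (a + b) ≤ n) :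
    (up l (solution q a b c) : MonoidAlgebra k (BraidGroup n)) =
      solutionSeq (artinSeq k n) q a b c l := by
  rw [solution, solutionSeq]
  split_ifs with hc
  · rw [map_smul, map_mul, map_mul, up_up h (by omega), up_up h (by omega), up_up h (by omega),
      up_shuffle (by omega), up_beta (by omega), up_pochhammer _ (by omega), add_zero]
  · simp

theorem solution_isUniversalSolution (q : kˣ) : IsUniversalSolution (solution q) := by
  refine ⟨fun a b c h => by rw [solution, if_neg (by omega)], fun a b c e f => ?_⟩
  have := solutionSeq_system (artinSeq_isBraidSeq k (a + b + c)) q a b c e f 0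
  simp only [zero_add] at this
  convert this using 1
  · refine Finset.sum_congr rfl fun i hi => ?_
    simp only [Finset.mem_filter, Finset.mem_Icc] at hi
    rw [up_solution q (by omega), up_solution q (by omega), up_solution q (by omega)]
  · refine Finset.sum_congr rfl fun j hj => ?_
    simp only [Finset.mem_filter, Finset.mem_Icc, le_min_iff] at hj
    rw [up_solution q (by omega), up_solution q (by omega), up_solution q (by omega)]

end Universal

/-! ### Intertwining properties of local representations -/

section Intertwine

variable {k : Type u} [Field k]

/-- Intertwining passes from generators to products and inverses, then to linear combinations. It
serves both the embedding of tensor powers into longer ones and functoriality. -/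
theorem lift_intertwine {m : ℕ} {M : Type*} [AddCommGroup M] [Module k M] {N : Type*}
    [AddCommGroup N] [Module k N] (ρ : BraidGroup m →* (Module.End k M)ˣ)
    (ρ' : BraidGroup m →* (Module.End k N)ˣ) (φ : M →ₗ[k] N)
    (h : ∀ i, i < m - 1 → ∀ x, φ ((ρ (sigma m i) : Module.End k M) x) =
      (ρ' (sigma m i) : Module.End k N) (φ x))
    (X : MonoidAlgebra k (BraidGroup m)) (x : M) :
    φ (MonoidAlgebra.lift k _ (BraidGroup m) ((Units.coeHom _).comp ρ) X x) =
      MonoidAlgebra.lift k _ (BraidGroup m) ((Units.coeHom _).comp ρ') X (φ x) := by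
  have hg : ∀ g : BraidGroup m, ∀ x, φ ((ρ g : Module.End k M) x) =
      (ρ' g : Module.End k N) (φ x) := by
    intro g
    have hmem : g ∈ Subgroup.closure (Set.range (PresentedGroup.of (rels := artinRels m))) := by
      rw [PresentedGroup.closure_range_of]; trivial
    induction hmem using Subgroup.closure_induction with
    | mem g hg =>
      obtain ⟨i, rfl⟩ := hg
      have := h i i.2
      simpa only [sigma, dif_pos i.2] using this
    | one => simp
    | mul a b _ _ ha hb => intro x; simp [ha, hb]
    | inv a _ ha =>
      intro x
      have h1 := ha ((ρ a⁻¹ : Module.End k M) x)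
      rw [← Module.End.mul_apply, ← Units.val_mul, ← map_mul, mul_inv_cancel, map_one] at h1
      rw [Units.val_one, Module.End.one_apply] at h1
      rw [h1, ← Module.End.mul_apply, ← Units.val_mul, ← map_mul, inv_mul_cancel, map_one,
        Units.val_one, Module.End.one_apply]
  induction X using MonoidAlgebra.induction_on with
  | of g => simpa using hg g x
  | add X Y hX hY => simp [hX, hY]
  | smul r X hX => simp [hX]

/-- Places the vectors `v` at the positions `l, …, l + m - 1` of the sequence `u`. -/
def placeAt {V : Type*} {n : ℕ} (l m : ℕ) (u : Fin n → V) (v : Fin m → V) : Fin n → V := fun i =>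
  if h : l ≤ i ∧ (i : ℕ) < l + m then v ⟨i - l, by omega⟩ else u i

theorem placeAt_update {V : Type*} {n l m : ℕ} (hlm : l + m ≤ n) (u : Fin n → V) (v : Fin m → V) (i : Fin m)
    (x : V) : placeAt l m u (Function.update v i x) =
      Function.update (placeAt l m u v) ⟨l + i, by omega⟩ x := by
  funext j
  by_cases hj : j = ⟨l + i, by omega⟩
  · subst hj
    simp [placeAt]
  · rw [Function.update_of_ne hj]
    unfold placeAt
    split_ifs with h
    · rw [Function.update_of_ne]
      intro he
      apply hj
      ext
      have := congrArg Fin.val he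
      simp only at this ⊢
      omega
    · rfl

theorem placeAt_apply {V : Type*} {n l m : ℕ} (hlm : l + m ≤ n) (u : Fin n → V) (v : Fin m → V) (i : Fin m) :
    placeAt l m u v ⟨l + i, by omega⟩ = v i := by
  simp [placeAt]

variable {V : Type v} [AddCommGroup V] [Module k V]

theorem localRep_sigma (R : Module.End k (V ⊗[k] V)) (hR : IsBraiding R) {n i : ℕ}
    (h : i < n - 1) :
    (localRep R hR n (sigma n i) : Module.End k (⨂[k]^n V)) =
      twoSite (⟨i, by omega⟩ : Fin n) ⟨i + 1, by omega⟩ (by simp) R := by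
  rw [localRep, liftBraid_sigma _ _ _ _ _ h, siteUnit, dif_pos h]
  rfl

/-- Filling the positions outside a window of `m` factors with fixed vectors turns $\sigma_i$ into
$\sigma_{i+l}$. Left and right multiplication and the casts of tensor powers are the special cases
used. -/
theorem localRepAlg_up_place (R : Module.End k (V ⊗[k] V)) (hR : IsBraiding R) {l m n : ℕ}
    (hlm : l + m ≤ n) (φ : ⨂[k]^m V →ₗ[k] ⨂[k]^n V) (u : Fin n → V)
    (hφ : ∀ v, φ (PiTensorProduct.tprod k v) = PiTensorProduct.tprod k (placeAt l m u v))
    (X : MonoidAlgebra k (BraidGroup m)) (x : ⨂[k]^m V) :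
    φ (localRepAlg R hR m X x) = localRepAlg R hR n (up l X) (φ x) := by
  have key := lift_intertwine (localRep R hR m) ((localRep R hR n).comp (shiftGroup l m n)) φ
    (fun i hi x => by
      rw [MonoidHom.comp_apply, shiftGroup_sigma hlm hi, localRep_sigma R hR hi,
        localRep_sigma R hR (by omega)]
      suffices H : φ ∘ₗ twoSite (⟨i, by omega⟩ : Fin m) ⟨i + 1, by omega⟩ (by simp) R =
          twoSite (⟨i + l, by omega⟩ : Fin n) ⟨i + l + 1, by omega⟩ (by simp) R ∘ₗ φ from
        LinearMap.congr_fun H x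
      refine PiTensorProduct.ext (MultilinearMap.ext fun v => ?_)
      simp only [LinearMap.compMultilinearMap_apply, LinearMap.comp_apply, hφ, twoSite_tprod]
      have e1 := placeAt_apply hlm u v ⟨i, by omega⟩
      have e2 := placeAt_apply hlm u v ⟨i + 1, by omega⟩
      simp only [add_comm l, add_right_comm i 1 l] at e1 e2
      rw [e1, e2]
      generalize R _ = t
      suffices H : φ ∘ₗ insertPair v (⟨i, by omega⟩ : Fin m) ⟨i + 1, by omega⟩ (by simp) =
          insertPair (placeAt l m u v) (⟨i + l, by omega⟩ : Fin n) ⟨i + l + 1, by omega⟩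
            (by simp) from LinearMap.congr_fun H t
      refine TensorProduct.ext' fun a b => ?_
      rw [LinearMap.comp_apply, insertPair_tmul, insertPair_tmul, hφ, placeAt_update hlm,
        placeAt_update hlm]
      simp only [add_comm l, add_right_comm i 1 l]) X x
  rw [localRepAlg, key]
  have : (localRepAlg R hR n).comp (up l) = MonoidAlgebra.lift k _ (BraidGroup m)
      ((Units.coeHom _).comp ((localRep R hR n).comp (shiftGroup l m n))) := by
    refine groupAlgebra_algHom_ext fun g => ?_
    rw [AlgHom.comp_apply, up_of]
    simp [localRepAlg]
  rw [← this]
  rfl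

/-- The linear map `⨂^b V → ⨂^n V`, `y ↦ x y`. -/
def mulLeftCast {n a b : ℕ} (h : a + b = n) (x : ⨂[k]^a V) : ⨂[k]^b V →ₗ[k] ⨂[k]^n V :=
  (TensorPower.cast k V h).toLinearMap ∘ₗ TensorPower.mulEquiv.toLinearMap ∘ₗ
    TensorProduct.mk k _ _ x

/-- The linear map `⨂^a V → ⨂^n V`, `x ↦ x y`. -/
def mulRightCast {n a b : ℕ} (h : a + b = n) (y : ⨂[k]^b V) : ⨂[k]^a V →ₗ[k] ⨂[k]^n V :=
  (TensorPower.cast k V h).toLinearMap ∘ₗ TensorPower.mulEquiv.toLinearMap ∘ₗ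
    (TensorProduct.mk k _ _).flip y

theorem mulEquiv_tprod {a b : ℕ} (x : Fin a → V) (y : Fin b → V) :
    TensorPower.mulEquiv (PiTensorProduct.tprod k x ⊗ₜ[k] PiTensorProduct.tprod k y) =
      PiTensorProduct.tprod k (Fin.append x y) :=
  TensorPower.tprod_mul_tprod k x y

theorem localRepAlg_mulLeft (R : Module.End k (V ⊗[k] V)) (hR : IsBraiding R) {n a b : ℕ}
    (h : a + b = n) (x : Fin a → V) (X : MonoidAlgebra k (BraidGroup b)) (y : ⨂[k]^b V) :
    mulLeftCast h (PiTensorProduct.tprod k x) (localRepAlg R hR b X y) =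
      localRepAlg R hR n (up a X) (mulLeftCast h (PiTensorProduct.tprod k x) y) := by
  refine localRepAlg_up_place R hR (by omega) _
    (fun i => if hi : (i : ℕ) < a then x ⟨i, hi⟩ else 0) (fun v => ?_) X y
  subst h
  simp only [mulLeftCast, LinearMap.comp_apply, TensorProduct.mk_apply, LinearEquiv.coe_coe,
    mulEquiv_tprod, TensorPower.cast_refl, LinearEquiv.refl_apply]
  congr 1
  funext i
  refine Fin.addCases (fun i => ?_) (fun i => ?_) i
  · rw [Fin.append_left]
    simp [placeAt]
  · rw [Fin.append_right]
    simp [placeAt]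

theorem localRepAlg_mulRight (R : Module.End k (V ⊗[k] V)) (hR : IsBraiding R) {n a b : ℕ}
    (h : a + b = n) (y : Fin b → V) (X : MonoidAlgebra k (BraidGroup a)) (x : ⨂[k]^a V) :
    mulRightCast h (PiTensorProduct.tprod k y) (localRepAlg R hR a X x) =
      localRepAlg R hR n (up 0 X) (mulRightCast h (PiTensorProduct.tprod k y) x) := by
  refine localRepAlg_up_place R hR (by omega) _
    (fun i => if hi : a ≤ (i : ℕ) then y ⟨i - a, by omega⟩ else 0) (fun v => ?_) X x
  subst h
  simp only [mulRightCast, LinearMap.comp_apply, LinearMap.flip_apply, TensorProduct.mk_apply,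
    LinearEquiv.coe_coe, mulEquiv_tprod, TensorPower.cast_refl, LinearEquiv.refl_apply]
  congr 1
  funext i
  refine Fin.addCases (fun i => ?_) (fun i => ?_) i
  · rw [Fin.append_left]
    simp [placeAt]
  · rw [Fin.append_right]
    simp [placeAt]

theorem localRepAlg_cast (R : Module.End k (V ⊗[k] V)) (hR : IsBraiding R) {n m : ℕ}
    (h : m = n) (X : MonoidAlgebra k (BraidGroup m)) (x : ⨂[k]^m V) :
    TensorPower.cast k V h (localRepAlg R hR m X x) =
      localRepAlg R hR n (up 0 X) (TensorPower.cast k V h x) := by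
  refine localRepAlg_up_place R hR (by omega) (TensorPower.cast k V h).toLinearMap
    (fun i => 0) (fun v => ?_) X x
  subst h
  simp only [TensorPower.cast_refl, LinearEquiv.coe_coe, LinearEquiv.refl_apply]
  congr 1
  funext i
  simp [placeAt]

theorem localRepAlg_map (R : Module.End k (V ⊗[k] V)) (hR : IsBraiding R)
    {V' : Type w} [AddCommGroup V'] [Module k V'] (R' : Module.End k (V' ⊗[k] V'))
    (hR' : IsBraiding R') (f : V →ₗ[k] V')
    (hf : TensorProduct.map f f ∘ₗ R = R' ∘ₗ TensorProduct.map f f) {n : ℕ}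
    (X : MonoidAlgebra k (BraidGroup n)) (x : ⨂[k]^n V) :
    PiTensorProduct.map (fun _ : Fin n => f) (localRepAlg R hR n X x) =
      localRepAlg R' hR' n X (PiTensorProduct.map (fun _ : Fin n => f) x) := by
  refine lift_intertwine (localRep R hR n) (localRep R' hR' n) _ (fun i hi x => ?_) X x
  rw [localRep_sigma R hR hi, localRep_sigma R' hR' hi]
  rw [← LinearMap.comp_apply, ← LinearMap.comp_apply]
  congr 1
  refine PiTensorProduct.ext (MultilinearMap.ext fun v => ?_)
  simp only [LinearMap.compMultilinearMap_apply, LinearMap.comp_apply, PiTensorProduct.map_tprod,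
    twoSite_tprod]
  rw [← TensorProduct.map_tmul, ← LinearMap.comp_apply R', ← hf, LinearMap.comp_apply]
  generalize R _ = t
  rw [← LinearMap.comp_apply, ← LinearMap.comp_apply]
  congr 1
  refine TensorProduct.ext' fun a b => ?_
  simp only [LinearMap.comp_apply, insertPair_tmul, PiTensorProduct.map_tprod,
    TensorProduct.map_tmul]
  congr 1
  funext j
  simp only [Function.update_apply]
  split_ifs <;> rfl

end Intertwine

/-! ### The operator on the tensor space -/

section TensorOperator

variable {k : Type u} [Field k] {V : Type v} [AddCommGroup V] [Module k V]

/-- The inclusion `V^{⊗n} → T(V)`. -/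
abbrev incl (k : Type u) [Field k] (V : Type v) [AddCommGroup V] [Module k V] (n : ℕ) :
    ⨂[k]^n V →ₗ[k] TensorSpace k V :=
  DirectSum.lof k ℕ (fun n => ⨂[k]^n V) n

/-- The map `V^{⊗n} = V^{⊗a} ⊗ V^{⊗b} → T(V) ⊗ T(V)` for `n = a + b`, and zero otherwise. -/
def incl₂ (k : Type u) [Field k] (V : Type v) [AddCommGroup V] [Module k V] (n a b : ℕ) :
    ⨂[k]^n V →ₗ[k] TensorSpace k V ⊗[k] TensorSpace k V :=
  if h : n = a + b then
    TensorProduct.map (incl k V a) (incl k V b) ∘ₗ TensorPower.mulEquiv.symm.toLinearMap ∘ₗ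
      (TensorPower.cast k V h).toLinearMap
  else 0

/-- The map `V^{⊗n} = V^{⊗a} ⊗ V^{⊗b} ⊗ V^{⊗c} → T(V) ⊗ T(V) ⊗ T(V)` for `n = a + b + c`, and zero
otherwise. -/
def incl₃ (k : Type u) [Field k] (V : Type v) [AddCommGroup V] [Module k V] (n a b c : ℕ) :
    ⨂[k]^n V →ₗ[k] TensorSpace k V ⊗[k] (TensorSpace k V ⊗[k] TensorSpace k V) :=
  if h : n = a + (b + c) then
    TensorProduct.map (incl k V a) (incl₂ k V (b + c) b c) ∘ₗ
      TensorPower.mulEquiv.symm.toLinearMap ∘ₗ (TensorPower.cast k V h).toLinearMap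
  else 0

theorem incl₂_mulEquiv {n a b : ℕ} (h : a + b = n) (x : ⨂[k]^a V) (y : ⨂[k]^b V) :
    incl₂ k V n a b (TensorPower.cast k V h (TensorPower.mulEquiv (x ⊗ₜ[k] y))) =
      incl k V a x ⊗ₜ[k] incl k V b y := by
  subst h
  simp [incl₂]

theorem incl₃_mulLeft {n m a b c : ℕ} (h : a + m = n) (hm : m = b + c) (x : ⨂[k]^a V)
    (y : ⨂[k]^m V) :
    incl₃ k V n a b c (mulLeftCast h x y) = incl k V a x ⊗ₜ[k] incl₂ k V m b c y := by
  subst hm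
  subst h
  simp [incl₃, mulLeftCast]

theorem cast_mulEquiv_assoc {n m a b c : ℕ} (h : m + c = n) (hm : a + b = m)
    (x : ⨂[k]^a V) (y : ⨂[k]^b V) (z : ⨂[k]^c V) :
    mulRightCast h z (TensorPower.cast k V hm (TensorPower.mulEquiv (x ⊗ₜ[k] y))) =
      mulLeftCast (by omega : a + (b + c) = n) x (TensorPower.mulEquiv (y ⊗ₜ[k] z)) := by
  subst hm
  subst h
  have := TensorPower.mul_assoc x y z
  simp only [TensorPower.gMul_def] at this
  simp only [mulRightCast, mulLeftCast, LinearMap.comp_apply, TensorPower.cast_refl,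
    LinearEquiv.refl_apply, LinearEquiv.coe_coe, LinearMap.flip_apply, TensorProduct.mk_apply]
  rw [← this, TensorPower.cast_cast, TensorPower.cast_refl, LinearEquiv.refl_apply]

/-- `incl₃` brackets to the right, whereas `act12` needs the left bracketing; associativity of the
multiplication of tensor powers reconciles them. -/
theorem incl₃_mulRight {n m a b c : ℕ} (h : m + c = n) (hm : m = a + b) (x : ⨂[k]^m V)
    (y : ⨂[k]^c V) :
    incl₃ k V n a b c (mulRightCast h y x) =
      TensorProduct.assoc k _ _ _ (incl₂ k V m a b x ⊗ₜ[k] incl k V c y) := by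
  subst hm
  suffices H : incl₃ k V n a b c ∘ₗ mulRightCast h y ∘ₗ TensorPower.mulEquiv.toLinearMap =
      (TensorProduct.assoc k _ _ _).toLinearMap ∘ₗ (TensorProduct.mk k _ _).flip (incl k V c y) ∘ₗ
        incl₂ k V (a + b) a b ∘ₗ TensorPower.mulEquiv.toLinearMap by
    have := LinearMap.congr_fun H (TensorPower.mulEquiv.symm x)
    simpa using this
  refine TensorProduct.ext' fun u v => ?_
  have h1 := cast_mulEquiv_assoc h rfl u v y
  have h2 := incl₂_mulEquiv (k := k) (V := V) rfl u v
  have h3 := incl₂_mulEquiv (k := k) (V := V) rfl v y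
  simp only [TensorPower.cast_refl, LinearEquiv.refl_apply] at h1 h2 h3
  simp only [LinearMap.comp_apply, LinearEquiv.coe_coe, h1, h2, LinearMap.flip_apply,
    TensorProduct.mk_apply, TensorProduct.assoc_tmul]
  rw [incl₃_mulLeft _ rfl, h3]

variable (A : (a b : ℕ) → ℕ → MonoidAlgebra k (BraidGroup (a + b)))
  (S : Module.End k (V ⊗[k] V)) (hS : IsBraiding S)

/-- All blocks become operators on one space $V^{\otimes n}$ with a free index `n`, so that
compositions are products in the image of $\Bbbk B_n$. -/
theorem tensorOperator_incl₂ {n m l : ℕ} (h : m + l = n) (x : ⨂[k]^n V) :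
    tensorOperator A S hS (incl₂ k V n m l x) =
      ∑ r ∈ Finset.HasAntidiagonal.antidiagonal n,
        incl₂ k V n r.1 r.2 (localRepAlg S hS n (up 0 (A r.1 r.2 m)) x) := by
  subst h
  obtain ⟨x, rfl⟩ :=
    (TensorPower.mulEquiv (R := k) (M := V) (n := m) (m := l)).surjective x
  induction x using TensorProduct.induction_on with
  | zero => simp only [map_zero, Finset.sum_const_zero]
  | add x y hx hy => simp only [map_add, hx, hy, Finset.sum_add_distrib]
  | tmul x y =>
    have h2 := incl₂_mulEquiv (k := k) (V := V) rfl x y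
    rw [TensorPower.cast_refl, LinearEquiv.refl_apply] at h2
    rw [h2, tensorOperator, LinearMap.comp_apply, LinearEquiv.coe_coe,
      TensorProduct.directSum_lof_tmul_lof, DirectSum.toModule_lof, LinearMap.sum_apply,
      ← Finset.sum_coe_sort (Finset.HasAntidiagonal.antidiagonal (m + l))]
    refine Finset.sum_congr rfl fun r _ => ?_
    have hr : r.1.1 + r.1.2 = m + l := Finset.HasAntidiagonal.mem_antidiagonal.mp r.2
    rw [incl₂, dif_pos hr.symm]
    simp only [LinearMap.comp_apply, block, LinearEquiv.coe_coe]
    have := localRepAlg_cast S hS hr (A r.1.1 r.1.2 m)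
      (TensorPower.cast k V hr.symm (TensorPower.mulEquiv (x ⊗ₜ[k] y)))
    rw [TensorPower.cast_cast, TensorPower.cast_refl, LinearEquiv.refl_apply] at this
    rw [← this, TensorPower.cast_cast, TensorPower.cast_refl, LinearEquiv.refl_apply]

theorem act23_tensorOperator_incl₃ {n a b c : ℕ} (h : a + (b + c) = n) (x : ⨂[k]^n V) :
    act23 (tensorOperator A S hS) (incl₃ k V n a b c x) =
      ∑ r ∈ Finset.HasAntidiagonal.antidiagonal (b + c),
        incl₃ k V n a r.1 r.2 (localRepAlg S hS n (up a (A r.1 r.2 b)) x) := by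
  suffices H : act23 (tensorOperator A S hS) ∘ₗ incl₃ k V n a b c =
      ∑ r ∈ Finset.HasAntidiagonal.antidiagonal (b + c),
        incl₃ k V n a r.1 r.2 ∘ₗ localRepAlg S hS n (up a (A r.1 r.2 b)) by
    simpa [LinearMap.sum_apply] using LinearMap.congr_fun H x
  refine PiTensorProduct.ext (MultilinearMap.ext fun v => ?_)
  obtain ⟨x, y, hv⟩ : ∃ (x : Fin a → V) (y : Fin (b + c) → V), PiTensorProduct.tprod k v =
      mulLeftCast h (PiTensorProduct.tprod k x) (PiTensorProduct.tprod k y) := by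
    subst h
    refine ⟨fun i => v (Fin.castAdd _ i), fun i => v (Fin.natAdd _ i), ?_⟩
    simp only [mulLeftCast, LinearMap.comp_apply, TensorProduct.mk_apply, LinearEquiv.coe_coe,
      mulEquiv_tprod, TensorPower.cast_refl, LinearEquiv.refl_apply]
    rw [Fin.append_castAdd_natAdd]
  simp only [LinearMap.compMultilinearMap_apply, LinearMap.comp_apply, LinearMap.sum_apply, hv]
  rw [incl₃_mulLeft h rfl, act23, LinearMap.lTensor_tmul, tensorOperator_incl₂ A S hS rfl,
    TensorProduct.tmul_sum]
  refine Finset.sum_congr rfl fun r hr => ?_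
  rw [Finset.HasAntidiagonal.mem_antidiagonal] at hr
  have e : up a (A r.1 r.2 b) = (up a (up 0 (A r.1 r.2 b) : MonoidAlgebra k (BraidGroup (b + c))) :
      MonoidAlgebra k (BraidGroup n)) := by
    rw [up_up (by omega) (by omega), add_zero]
  rw [e, ← localRepAlg_mulLeft, incl₃_mulLeft h hr.symm]

theorem act12_tensorOperator_incl₃ {n a b c : ℕ} (h : a + (b + c) = n) (x : ⨂[k]^n V) :
    act12 (tensorOperator A S hS) (incl₃ k V n a b c x) =
      ∑ r ∈ Finset.HasAntidiagonal.antidiagonal (a + b),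
        incl₃ k V n r.1 r.2 c (localRepAlg S hS n (up 0 (A r.1 r.2 a)) x) := by
  replace h : (a + b) + c = n := by omega
  suffices H : act12 (tensorOperator A S hS) ∘ₗ incl₃ k V n a b c =
      ∑ r ∈ Finset.HasAntidiagonal.antidiagonal (a + b),
        incl₃ k V n r.1 r.2 c ∘ₗ localRepAlg S hS n (up 0 (A r.1 r.2 a)) by
    simpa [LinearMap.sum_apply] using LinearMap.congr_fun H x
  refine PiTensorProduct.ext (MultilinearMap.ext fun v => ?_)
  obtain ⟨x, y, hv⟩ : ∃ (x : Fin (a + b) → V) (y : Fin c → V), PiTensorProduct.tprod k v =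
      mulRightCast h (PiTensorProduct.tprod k y) (PiTensorProduct.tprod k x) := by
    subst h
    refine ⟨fun i => v (Fin.castAdd _ i), fun i => v (Fin.natAdd _ i), ?_⟩
    simp only [mulRightCast, LinearMap.comp_apply, LinearMap.flip_apply, TensorProduct.mk_apply,
      LinearEquiv.coe_coe, mulEquiv_tprod, TensorPower.cast_refl, LinearEquiv.refl_apply]
    rw [Fin.append_castAdd_natAdd]
  simp only [LinearMap.compMultilinearMap_apply, LinearMap.comp_apply, LinearMap.sum_apply, hv]
  rw [incl₃_mulRight h rfl, act12, LinearEquiv.conj_apply_apply, LinearEquiv.symm_apply_apply,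
    LinearMap.rTensor_tmul, tensorOperator_incl₂ A S hS rfl, TensorProduct.sum_tmul, map_sum]
  refine Finset.sum_congr rfl fun r hr => ?_
  rw [Finset.HasAntidiagonal.mem_antidiagonal] at hr
  have e : up 0 (A r.1 r.2 a) = (up 0 (up 0 (A r.1 r.2 a) : MonoidAlgebra k (BraidGroup (a + b))) :
      MonoidAlgebra k (BraidGroup n)) := by
    rw [up_up (by omega) (by omega), add_zero]
  rw [e, ← localRepAlg_mulRight, incl₃_mulRight h hr.symm]

theorem tensorSpace_hom_ext₂ {M : Type*} [AddCommGroup M] [Module k M]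
    {F G : TensorSpace k V ⊗[k] TensorSpace k V →ₗ[k] M}
    (h : ∀ n a b, a + b = n → ∀ x, F (incl₂ k V n a b x) = G (incl₂ k V n a b x)) : F = G := by
  refine TensorProduct.ext (DirectSum.linearMap_ext _ fun a => LinearMap.ext fun x =>
    DirectSum.linearMap_ext _ fun b => LinearMap.ext fun y => ?_)
  have := h _ a b rfl (TensorPower.cast k V rfl (TensorPower.mulEquiv (x ⊗ₜ[k] y)))
  rw [incl₂_mulEquiv] at this
  exact this

theorem tensorSpace_hom_ext₃ {M : Type*} [AddCommGroup M] [Module k M]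
    {F G : TensorSpace k V ⊗[k] (TensorSpace k V ⊗[k] TensorSpace k V) →ₗ[k] M}
    (h : ∀ n a b c, a + (b + c) = n → ∀ x, F (incl₃ k V n a b c x) = G (incl₃ k V n a b c x)) :
    F = G := by
  refine TensorProduct.ext (DirectSum.linearMap_ext _ fun a => LinearMap.ext fun x =>
    tensorSpace_hom_ext₂ fun m b c hm y => ?_)
  have := h _ a b c rfl (mulLeftCast (by omega) x y)
  rw [incl₃_mulLeft (by omega) hm.symm] at this
  exact this

end TensorOperator

/-! ### The Yang--Baxter equation on the tensor space -/

section YangBaxter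

variable {k : Type u} [Field k] {V : Type v} [AddCommGroup V] [Module k V]

/-- Triples of natural numbers with sum `n`. -/
def triples (n : ℕ) : Finset (ℕ × ℕ × ℕ) :=
  (Finset.range (n + 1) ×ˢ Finset.range (n + 1) ×ˢ Finset.range (n + 1)).filter
    fun p => p.1 + p.2.1 + p.2.2 = n

theorem mem_triples {n : ℕ} {p : ℕ × ℕ × ℕ} : p ∈ triples n ↔ p.1 + p.2.1 + p.2.2 = n := by
  simp only [triples, Finset.mem_filter, Finset.mem_product, Finset.mem_range]
  omega

-- Composing three block operators sums over intermediate degrees, while the system fixes the output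
-- degrees $(a,b,c)$ and sums over $i$. The vanishing hypothesis discards terms outside the system's
-- range.
open Finset.HasAntidiagonal in
theorem sum_antidiagonal_left {M : Type*} [AddCommMonoid M] {n e f g : ℕ} (h : e + (f + g) = n)
    (F : ℕ → ℕ → ℕ → ℕ → M) (hF : ∀ a b c i, ¬(e ≤ i ∧ i ≤ c ∧ i + f ≤ b + c) → F a b c i = 0) :
    ∑ p ∈ antidiagonal (f + g), ∑ r ∈ antidiagonal (e + p.1), ∑ u ∈ antidiagonal (r.2 + p.2),
      F r.1 u.1 u.2 r.2 =
    ∑ p ∈ triples n, ∑ i ∈ Finset.Icc e p.2.2 with i + f ≤ p.2.1 + p.2.2,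
      F p.1 p.2.1 p.2.2 i := by
  simp only [Finset.sum_sigma']
  refine Finset.sum_bij_ne_zero (fun x _ _ => ⟨(x.2.1.1, x.2.2.1, x.2.2.2), x.2.1.2⟩) ?_ ?_ ?_ ?_
  · rintro ⟨⟨p1, p2⟩, ⟨r1, r2⟩, ⟨u1, u2⟩⟩ hx h0
    have := not_imp_comm.mp (hF _ _ _ _) h0
    simp only [Finset.mem_sigma, mem_antidiagonal, mem_triples, Finset.mem_filter,
      Finset.mem_Icc] at *
    omega
  · rintro ⟨⟨p1, p2⟩, ⟨r1, r2⟩, ⟨u1, u2⟩⟩ hx _ ⟨⟨p1', p2'⟩, ⟨r1', r2'⟩, ⟨u1', u2'⟩⟩ hx' _ he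
    simp only [Finset.mem_sigma, mem_antidiagonal, Sigma.mk.injEq, Prod.mk.injEq, heq_eq_eq] at *
    omega
  · rintro ⟨⟨a, b, c⟩, i⟩ hx h0
    simp only [Finset.mem_sigma, mem_triples, Finset.mem_filter, Finset.mem_Icc] at hx
    refine ⟨⟨(a + i - e, b + c - i), (a, i), (b, c)⟩, ?_, h0, rfl⟩
    simp only [Finset.mem_sigma, mem_antidiagonal]
    omega
  · intros
    rfl

-- The analogue for the other triple product. The bound `j ≤ e + f` holds for all indices that occur
-- and prevents truncation in `f + e - j`, without which the vanishing could fail for `e = 0`.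
open Finset.HasAntidiagonal in
theorem sum_antidiagonal_right {M : Type*} [AddCommMonoid M] {n e f g : ℕ} (h : e + (f + g) = n)
    (F : ℕ → ℕ → ℕ → ℕ → M) (hF : ∀ a b c j, j ≤ e + f → ¬(j ≤ f ∧ j ≤ b ∧ f + e ≤ j + c) → F a b c j = 0) :
    ∑ p ∈ antidiagonal (e + f), ∑ r ∈ antidiagonal (p.2 + g), ∑ u ∈ antidiagonal (p.1 + r.1),
      F u.1 u.2 r.2 p.1 =
    ∑ p ∈ triples n, ∑ j ∈ Finset.Icc 0 (min f p.2.1) with f + e ≤ j + p.2.2,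
      F p.1 p.2.1 p.2.2 j := by
  simp only [Finset.sum_sigma']
  refine Finset.sum_bij_ne_zero (fun x _ _ => ⟨(x.2.2.1, x.2.2.2, x.2.1.2), x.1.1⟩) ?_ ?_ ?_ ?_
  · rintro ⟨⟨p1, p2⟩, ⟨r1, r2⟩, ⟨u1, u2⟩⟩ hx h0
    have hp : p1 ≤ e + f := by
      simp only [Finset.mem_sigma, mem_antidiagonal] at hx
      omega
    have := not_imp_comm.mp (hF _ _ _ _ hp) h0
    simp only [Finset.mem_sigma, mem_antidiagonal, mem_triples, Finset.mem_filter,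
      Finset.mem_Icc, le_min_iff] at *
    omega
  · rintro ⟨⟨p1, p2⟩, ⟨r1, r2⟩, ⟨u1, u2⟩⟩ hx _ ⟨⟨p1', p2'⟩, ⟨r1', r2'⟩, ⟨u1', u2'⟩⟩ hx' _ he
    simp only [Finset.mem_sigma, mem_antidiagonal, Sigma.mk.injEq, Prod.mk.injEq, heq_eq_eq] at *
    omega
  · rintro ⟨⟨a, b, c⟩, j⟩ hx h0
    simp only [Finset.mem_sigma, mem_triples, Finset.mem_filter, Finset.mem_Icc, le_min_iff] at hx
    refine ⟨⟨(j, f + e - j), (a + b - j, c), (a, b)⟩, ?_, h0, rfl⟩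
    simp only [Finset.mem_sigma, mem_antidiagonal]
    omega
  · intros
    rfl

variable {A : (a b : ℕ) → ℕ → MonoidAlgebra k (BraidGroup (a + b))}
  (S : Module.End k (V ⊗[k] V)) (hS : IsBraiding S)

open Finset.HasAntidiagonal in
theorem tensorOperator_yangBaxter (hA : IsUniversalSolution A) :
    act12 (tensorOperator A S hS) * act23 (tensorOperator A S hS) *
        act12 (tensorOperator A S hS) =
      act23 (tensorOperator A S hS) * act12 (tensorOperator A S hS) *
        act23 (tensorOperator A S hS) := by
  refine tensorSpace_hom_ext₃ (k := k) (V := V)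
    (M := TensorSpace k V ⊗[k] (TensorSpace k V ⊗[k] TensorSpace k V)) fun n e f g h x => ?_
  simp only [Module.End.mul_apply]
  have hr : act12 (tensorOperator A S hS) (act23 (tensorOperator A S hS)
      (act12 (tensorOperator A S hS) (incl₃ k V n e f g x))) =
      ∑ p ∈ antidiagonal (e + f), ∑ r ∈ antidiagonal (p.2 + g), ∑ u ∈ antidiagonal (p.1 + r.1),
        incl₃ k V n u.1 u.2 r.2 (localRepAlg S hS n (up 0 (A u.1 u.2 p.1) *
          up p.1 (A (u.1 + u.2 - p.1) r.2 (f + e - p.1)) * up 0 (A p.1 (f + e - p.1) e)) x) := by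
    rw [act12_tensorOperator_incl₃ A S hS h, map_sum, map_sum]
    refine Finset.sum_congr rfl fun p hp => ?_
    rw [mem_antidiagonal] at hp
    rw [act23_tensorOperator_incl₃ A S hS (by omega), map_sum]
    refine Finset.sum_congr rfl fun r hr => ?_
    rw [mem_antidiagonal] at hr
    rw [act12_tensorOperator_incl₃ A S hS (by omega)]
    refine Finset.sum_congr rfl fun u hu => ?_
    rw [mem_antidiagonal] at hu
    rw [← show p.2 = f + e - p.1 by omega, ← show r.1 = u.1 + u.2 - p.1 by omega]
    simp only [map_mul, Module.End.mul_apply]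
  have hl : act23 (tensorOperator A S hS) (act12 (tensorOperator A S hS)
      (act23 (tensorOperator A S hS) (incl₃ k V n e f g x))) =
      ∑ p ∈ antidiagonal (f + g), ∑ r ∈ antidiagonal (e + p.1), ∑ u ∈ antidiagonal (r.2 + p.2),
        incl₃ k V n r.1 u.1 u.2 (localRepAlg S hS n (up r.1 (A u.1 u.2 r.2) *
          up 0 (A r.1 r.2 e) * up e (A (r.1 + r.2 - e) (u.1 + u.2 - r.2) f)) x) := by
    rw [act23_tensorOperator_incl₃ A S hS h, map_sum, map_sum]
    refine Finset.sum_congr rfl fun p hp => ?_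
    rw [mem_antidiagonal] at hp
    rw [act12_tensorOperator_incl₃ A S hS (by omega), map_sum]
    refine Finset.sum_congr rfl fun r hr => ?_
    rw [mem_antidiagonal] at hr
    rw [act23_tensorOperator_incl₃ A S hS (by omega)]
    refine Finset.sum_congr rfl fun u hu => ?_
    rw [mem_antidiagonal] at hu
    rw [← show p.2 = u.1 + u.2 - r.2 by omega, ← show p.1 = r.1 + r.2 - e by omega]
    simp only [map_mul, Module.End.mul_apply]
  obtain ⟨hA0, hA1⟩ := hA
  rw [hr, hl, sum_antidiagonal_left h (fun a b c i => incl₃ k V n a b c (localRepAlg S hS n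
      (up a (A b c i) * up 0 (A a i e) * up e (A (a + i - e) (b + c - i) f)) x)) ?_,
    sum_antidiagonal_right h (fun a b c j => incl₃ k V n a b c (localRepAlg S hS n
      (up 0 (A a b j) * up j (A (a + b - j) c (f + e - j)) * up 0 (A j (f + e - j) e)) x)) ?_]
  · refine Finset.sum_congr rfl fun p hp => ?_
    obtain ⟨a, b, c⟩ := p
    rw [mem_triples] at hp
    simp only at hp ⊢
    subst hp
    have := congrArg (fun X => incl₃ k V _ a b c (localRepAlg S hS _ X x)) (hA1 a b c e f)
    simp only [map_sum, LinearMap.sum_apply] at this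
    exact this.symm
  -- Each violated bound puts the lower index of one of the three factors above its second upper
  -- index, so that factor is zero.
  · intro a b c j hje hj
    by_cases h1 : b < j
    · simp [hA0 _ _ _ h1]
    by_cases h2 : c < f + e - j
    · simp [hA0 _ _ _ h2]
    have h3 : f + e - j < e := by omega
    simp [hA0 _ _ _ h3]
  · intro a b c i hi
    by_cases h1 : c < i
    · simp [hA0 _ _ _ h1]
    by_cases h2 : i < e
    · simp [hA0 _ _ _ h2]
    have h3 : b + c - i < f := by omega
    simp [hA0 _ _ _ h3]

end YangBaxter

/-! ### Invertibility -/

section Invertible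

variable {k : Type u} [Field k]

theorem add_neg_one_smul {M : Type*} [AddCommMonoid M] [Module k M] (x : M) :
    x + (-1 : k) • x = 0 := by
  nth_rewrite 1 [← one_smul k x]
  rw [← add_smul, add_neg_cancel, zero_smul]

variable {V : Type v} [AddCommGroup V] [Module k V]
  {A : (a b : ℕ) → ℕ → MonoidAlgebra k (BraidGroup (a + b))}
  (S : Module.End k (V ⊗[k] V)) (hS : IsBraiding S)

/-- The action on `V^{⊗n}` of the element `A^{a,n-a}_c`. -/
def blockAct (A : (a b : ℕ) → ℕ → MonoidAlgebra k (BraidGroup (a + b)))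
    (S : Module.End k (V ⊗[k] V)) (hS : IsBraiding S) (n a c : ℕ) : Module.End k (⨂[k]^n V) :=
  localRepAlg S hS n (up 0 (A a (n - a) c))

/-- The restriction to `V^{⊗b} ⊗ V^{⊗(n-b)} = V^{⊗n}` of the inverse of the operator given by a
triangular family: the solution of a triangular system of linear equations. -/
def inverseBlock (A : (a b : ℕ) → ℕ → MonoidAlgebra k (BraidGroup (a + b)))
    (S : Module.End k (V ⊗[k] V)) (hS : IsBraiding S) (n : ℕ) :
    ℕ → ⨂[k]^n V →ₗ[k] TensorSpace k V ⊗[k] TensorSpace k V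
  | b => (incl₂ k V n (n - b) b + (-1 : k) •
      ∑ i : Fin b, inverseBlock A S hS n i ∘ₗ blockAct A S hS n i (n - b)) ∘ₗ
        Ring.inverse (blockAct A S hS n b (n - b))

theorem inverseBlock_apply (n b : ℕ) (x : ⨂[k]^n V) :
    inverseBlock A S hS n b x =
      incl₂ k V n (n - b) b (Ring.inverse (blockAct A S hS n b (n - b)) x) + (-1 : k) •
        ∑ i ∈ Finset.range b, inverseBlock A S hS n i (blockAct A S hS n i (n - b)
          (Ring.inverse (blockAct A S hS n b (n - b)) x)) := by
  rw [inverseBlock, LinearMap.comp_apply, LinearMap.add_apply, LinearMap.smul_apply, LinearMap.sum_apply,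
    ← Fin.sum_univ_eq_sum_range fun i => inverseBlock A S hS n i (blockAct A S hS n i (n - b)
          (Ring.inverse (blockAct A S hS n b (n - b)) x))]
  rfl

/-- For $i>b$ the block $A^{i,n-i}_{n-b}$ vanishes, as $n-b>n-i$. The diagonal therefore pairs the
source $V^{\otimes n-b}\otimes V^{\otimes b}$ with the target $V^{\otimes b}\otimes V^{\otimes
n-b}$. -/
theorem tensorOperator_incl₂_triangular (hA : ∀ a b c, b < c → A a b c = 0) {n b : ℕ}
    (hb : b ≤ n) (x : ⨂[k]^n V) :
    tensorOperator A S hS (incl₂ k V n (n - b) b x) =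
      ∑ i ∈ Finset.range b, incl₂ k V n i (n - i) (blockAct A S hS n i (n - b) x) +
        incl₂ k V n b (n - b) (blockAct A S hS n b (n - b) x) := by
  rw [tensorOperator_incl₂ A S hS (by omega),
    Finset.Nat.sum_antidiagonal_eq_sum_range_succ fun i j =>
      incl₂ k V n i j (localRepAlg S hS n (up 0 (A i j (n - b))) x),
    ← Finset.sum_range_succ fun i => incl₂ k V n i (n - i) (blockAct A S hS n i (n - b) x)]
  symm
  refine Finset.sum_subset (fun i => by simp only [Finset.mem_range]; omega) fun i hi hi' => ?_
  simp only [Finset.mem_range] at hi hi'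
  rw [blockAct, hA _ _ _ (by omega)]
  simp

/-- The inverse of the operator on `T(V) ⊗ T(V)` obtained from a triangular family. -/
def tensorOperatorInv (A : (a b : ℕ) → ℕ → MonoidAlgebra k (BraidGroup (a + b)))
    (S : Module.End k (V ⊗[k] V)) (hS : IsBraiding S) :
    Module.End k (TensorSpace k V ⊗[k] TensorSpace k V) :=
  (DirectSum.toModule k (ℕ × ℕ) (TensorSpace k V ⊗[k] TensorSpace k V) fun p =>
    inverseBlock A S hS (p.1 + p.2) p.1 ∘ₗ TensorPower.mulEquiv.toLinearMap) ∘ₗ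
  (TensorProduct.directSum k k (fun n : ℕ => ⨂[k]^n V) (fun n : ℕ => ⨂[k]^n V)).toLinearMap

theorem tensorOperatorInv_incl₂ {n b c : ℕ} (h : b + c = n) (x : ⨂[k]^n V) :
    tensorOperatorInv A S hS (incl₂ k V n b c x) = inverseBlock A S hS n b x := by
  subst h
  obtain ⟨x, rfl⟩ :=
    (TensorPower.mulEquiv (R := k) (M := V) (n := b) (m := c)).surjective x
  induction x using TensorProduct.induction_on with
  | zero => simp only [map_zero]
  | add x y hx hy => simp only [map_add, hx, hy]
  | tmul x y =>
    have h2 := incl₂_mulEquiv (k := k) (V := V) rfl x y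
    rw [TensorPower.cast_refl, LinearEquiv.refl_apply] at h2
    rw [h2, tensorOperatorInv, LinearMap.comp_apply, LinearEquiv.coe_coe,
      TensorProduct.directSum_lof_tmul_lof, DirectSum.toModule_lof, LinearMap.comp_apply,
      LinearEquiv.coe_coe]

theorem tensorOperator_isUnit (hA : ∀ a b c, b < c → A a b c = 0)
    (hu : ∀ n a c, a + c = n → IsUnit (up 0 (A a c c) : MonoidAlgebra k (BraidGroup n))) :
    IsUnit (tensorOperator A S hS) := by
  have hunit : ∀ n b, b ≤ n → IsUnit (blockAct A S hS n b (n - b)) := fun n b hb =>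
    (hu n b (n - b) (by omega)).map (localRepAlg S hS n)
  have h1 : tensorOperator A S hS * tensorOperatorInv A S hS = 1 := by
    refine tensorSpace_hom_ext₂ (k := k) (V := V) (M := TensorSpace k V ⊗[k] TensorSpace k V) fun n b c h x => ?_
    rw [Module.End.mul_apply, Module.End.one_apply, tensorOperatorInv_incl₂ S hS h]
    obtain rfl : c = n - b := by omega
    -- The right inverse needs induction, as `inverseBlock` calls itself at smaller degrees; for the
    -- left inverse below, unfolding it once already cancels the sum.
    induction b using Nat.strong_induction_on generalizing x with
    | _ b ih =>
      rw [inverseBlock_apply, map_add, map_smul, map_sum,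
        tensorOperator_incl₂_triangular S hS hA (by omega)]
      have : ∀ i ∈ Finset.range b, ∀ y, tensorOperator A S hS (inverseBlock A S hS n i y) =
          incl₂ k V n i (n - i) y := by
        intro i hi y
        rw [Finset.mem_range] at hi
        exact ih i hi _ (by omega)
      rw [Finset.sum_congr rfl fun i hi => this i hi _, add_right_comm, add_neg_one_smul, zero_add,
        ← Module.End.mul_apply, Ring.mul_inverse_cancel _ (hunit n b (by omega)),
        Module.End.one_apply]
  have h2 : tensorOperatorInv A S hS * tensorOperator A S hS = 1 := by
    refine tensorSpace_hom_ext₂ (k := k) (V := V) (M := TensorSpace k V ⊗[k] TensorSpace k V) fun n m b h x => ?_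
    rw [Module.End.mul_apply, Module.End.one_apply]
    obtain rfl : m = n - b := by omega
    rw [tensorOperator_incl₂_triangular S hS hA (by omega), map_add, map_sum,
      tensorOperatorInv_incl₂ S hS (by omega), inverseBlock_apply,
      ← Module.End.mul_apply (Ring.inverse _), Ring.inverse_mul_cancel _ (hunit n b (by omega)),
      Module.End.one_apply]
    rw [Finset.sum_congr rfl fun i hi => tensorOperatorInv_incl₂ S hS
      (by rw [Finset.mem_range] at hi; omega) _]
    rw [add_left_comm, add_neg_one_smul, add_zero]
  exact ⟨⟨_, _, h1, h2⟩, rfl⟩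

/-- On the diagonal the shuffle and Pochhammer factors are 1, leaving a power of $q$ times the braid
$\beta_{a,c}$. -/
theorem up_solution_diag_isUnit (q : kˣ) {n a c : ℕ} (h : a + c = n) :
    IsUnit (up 0 (solution q a c c) : MonoidAlgebra k (BraidGroup n)) := by
  rw [up_solution q (by omega), solutionSeq_of_eq _ q (n := 0) (by omega), shuffleSeq_zero_left,
    pochSeq_zero, one_mul, mul_one, ← up_beta (by omega), beta, up_of, ← Units.smul_def]
  exact ((Group.isUnit _).map (MonoidAlgebra.of k (BraidGroup n))).smul _

theorem tensorBraiding_isBraiding (q : kˣ) (R : Module.End k (V ⊗[k] V)) (hR : IsBraiding R) :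
    IsBraiding (tensorBraiding q R hR) :=
  ⟨tensorOperator_isUnit _ _ (solution_isUniversalSolution q).1
    fun _ _ _ h => up_solution_diag_isUnit q h,
    tensorOperator_yangBaxter _ _ (solution_isUniversalSolution q)⟩

end Invertible

/-! ### Functoriality -/

section Functoriality

variable {k : Type u} [Field k] {V : Type v} [AddCommGroup V] [Module k V]
  {V' : Type w} [AddCommGroup V'] [Module k V']

theorem tensorMap_incl₂ (f : V →ₗ[k] V') {n a b : ℕ} (h : a + b = n) (x : ⨂[k]^n V) :
    TensorProduct.map (tensorMap f) (tensorMap f) (incl₂ k V n a b x) =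
      incl₂ k V' n a b (PiTensorProduct.map (fun _ : Fin n => f) x) := by
  subst h
  rw [← LinearMap.comp_apply, ← LinearMap.comp_apply]
  congr 1
  refine PiTensorProduct.ext (MultilinearMap.ext fun v => ?_)
  obtain ⟨x, y, rfl⟩ : ∃ (x : Fin a → V) (y : Fin b → V), v = Fin.append x y :=
    ⟨fun i => v (Fin.castAdd _ i), fun i => v (Fin.natAdd _ i), Fin.append_castAdd_natAdd.symm⟩
  have h1 := incl₂_mulEquiv (k := k) rfl (PiTensorProduct.tprod k x) (PiTensorProduct.tprod k y)
  have h2 := incl₂_mulEquiv (k := k) rfl (PiTensorProduct.tprod k fun i => f (x i))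
    (PiTensorProduct.tprod k fun i => f (y i))
  rw [TensorPower.cast_refl, LinearEquiv.refl_apply, mulEquiv_tprod] at h1 h2
  simp only [LinearMap.compMultilinearMap_apply, LinearMap.comp_apply, PiTensorProduct.map_tprod]
  have h3 : (fun i => f (Fin.append x y i)) = Fin.append (fun i => f (x i)) fun i => f (y i) := by
    funext i
    refine Fin.addCases (fun i => ?_) (fun i => ?_) i <;> simp
  rw [h1, h3, h2, TensorProduct.map_tmul]
  simp [tensorMap, DirectSum.lmap_lof, PiTensorProduct.map_tprod]

/-- Every block is the image of a group algebra element, and $f^{\otimes n}$ intertwines such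
images; neither the system nor triangularity of `A` enters. -/
theorem tensorOperator_natural (A : (a b : ℕ) → ℕ → MonoidAlgebra k (BraidGroup (a + b)))
    (S : Module.End k (V ⊗[k] V)) (hS : IsBraiding S)
    (S' : Module.End k (V' ⊗[k] V')) (hS' : IsBraiding S') (f : V →ₗ[k] V')
    (hf : TensorProduct.map f f ∘ₗ S = S' ∘ₗ TensorProduct.map f f) :
    TensorProduct.map (tensorMap f) (tensorMap f) ∘ₗ tensorOperator A S hS =
      tensorOperator A S' hS' ∘ₗ TensorProduct.map (tensorMap f) (tensorMap f) := by
  refine tensorSpace_hom_ext₂ (k := k) (V := V)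
    (M := TensorSpace k V' ⊗[k] TensorSpace k V') fun n a b h x => ?_
  rw [LinearMap.comp_apply, LinearMap.comp_apply, tensorOperator_incl₂ A S hS h, map_sum,
    tensorMap_incl₂ f h, tensorOperator_incl₂ A S' hS' h]
  refine Finset.sum_congr rfl fun r hr => ?_
  rw [Finset.HasAntidiagonal.mem_antidiagonal] at hr
  rw [tensorMap_incl₂ f hr, localRepAlg_map S hS S' hS' f hf]

theorem tensorBraiding_natural (q : kˣ) (R : Module.End k (V ⊗[k] V)) (hR : IsBraiding R)
    (R' : Module.End k (V' ⊗[k] V')) (hR' : IsBraiding R') (f : V →ₗ[k] V')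
    (hf : TensorProduct.map f f ∘ₗ R = R' ∘ₗ TensorProduct.map f f) :
    TensorProduct.map (tensorMap f) (tensorMap f) ∘ₗ tensorBraiding q R hR =
      tensorBraiding q R' hR' ∘ₗ TensorProduct.map (tensorMap f) (tensorMap f) :=
  tensorOperator_natural _ _ _ _ _ f (by rw [LinearMap.comp_smul, hf, LinearMap.smul_comp])

end Functoriality

end BraidTensor

end

theorem mainTheorem1 {k : Type*} [Field k] (q : kˣ) :
    -- the elements solve the universal block-triangular Yang--Baxter system
    BraidTensor.IsUniversalSolution (BraidTensor.solution q) ∧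
    -- `T(R)` is a braiding on `T(V)`, that is, an invertible solution of the Yang--Baxter equation
    (∀ (V : Type*) [AddCommGroup V] [Module k V] (R : Module.End k (V ⊗[k] V))
      (hR : BraidTensor.IsBraiding R),
      BraidTensor.IsBraiding (BraidTensor.tensorBraiding q R hR)) ∧
    -- functoriality: if `f` intertwines `R` and `R'`, then `T(f)` intertwines `T(R)` and `T(R')`
    (∀ (V : Type*) [AddCommGroup V] [Module k V] (V' : Type*) [AddCommGroup V'] [Module k V']
      (R : Module.End k (V ⊗[k] V)) (hR : BraidTensor.IsBraiding R)
      (R' : Module.End k (V' ⊗[k] V')) (hR' : BraidTensor.IsBraiding R') (f : V →ₗ[k] V'),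
      TensorProduct.map f f ∘ₗ R = R' ∘ₗ TensorProduct.map f f →
      TensorProduct.map (BraidTensor.tensorMap f) (BraidTensor.tensorMap f) ∘ₗ
          BraidTensor.tensorBraiding q R hR =
        BraidTensor.tensorBraiding q R' hR' ∘ₗ
          TensorProduct.map (BraidTensor.tensorMap f) (BraidTensor.tensorMap f)) :=
  ⟨BraidTensor.solution_isUniversalSolution q,
    fun _ _ _ R hR => BraidTensor.tensorBraiding_isBraiding q R hR,
    fun _ _ _ _ _ _ R hR R' hR' f hf => BraidTensor.tensorBraiding_natural q R hR R' hR' f hf⟩
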